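/- **Setting.** Let $d$ be odd, and let labels $n,k,p$ range over the integers in $[-\frac{d-1}{2},\frac{d-1}{2}]$. On $\mathbb C^d$ with orthonormal energy basis $|n\rangle$ put $\hat H_d=\frac{2\pi}{\sqrt d}\sum_n n|n\rangle\langle n|$ and $|\theta_k\rangle=\frac1{\sqrt d}\sum_n e^{-2\pi i kn/d}|n\rangle$. Let $\theta_3(z,\tau)=\sum_{m\in\mathbb Z}e^{i\pi\tau m^2+2\pi i mz}$. For $\xi>0$ and $n_0\in\mathbb Z$ the clock starts in the quasi-ideal state $$|\Psi_0\rangle=\sum_k\psi(k)|\theta_k\rangle,\qquad \psi(k)=\frac{\sqrt{2/d}\;\theta_3\!\left(\frac kd,\frac{i\xi^2}{d}\right)e^{2\pi i n_0k/d}}{\sqrt{\theta_3\!\left(0,\frac{i\xi^2}{2d}\right)\theta_3\!\left(0,\frac{id\xi^2}{2}\right)+\theta_3\!\left(\frac12,\frac{i\xi^2}{2d}\right)\theta_3\!\left(\frac d2,\frac{id\xi^2}{2}\right)}} .$$ It is measured $J$ times with Kraus operators ($|\widetilde\xi|\le\frac{\sqrt d}{2}$) $$\hat\Omega(\widetilde\xi)=\frac{1}{d^{1/4}\sqrt{\theta_3(0,2i\sigma_m^2/d)}}\sum_k\theta_3\!\left(\frac{k-\widetilde\xi\sqrt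 d}{d},\frac{i\sigma_m^2}{d}\right)|\theta_k\rangle\langle\theta_k| ,$$ each measurement being preceded by free evolution $U=e^{-i\hat H_d\delta/\sqrt d}$ with $\delta=\frac12$. The outcomes $(\widetilde\xi_1,\dots,\widetilde\xi_J)\in[-\frac{\sqrt d}{2},\frac{\sqrt d}{2}]^J$ have joint density $\|\hat\Omega(\widetilde\xi_J)U\cdots\hat\Omega(\widetilde\xi_1)U|\Psi_0\rangle\|^2$, and $\langle\cdot\rangle$ is the expectation with respect to it. Let $\mathbf E^{p_1}$ be the expectation for the random walk $p_1,p_2,\dots$ on $\mathbb Z/d$ started at $p_1$ whose jumps are independent with distribution $q\mapsto\theta_3(\frac qd,\frac{i}{2\sigma_m^2d})\big/\big(\sqrt{2\sigma_m^2d}\,\theta_3(0,\frac{2i\sigma_m^2}{d})\big)$. **Statement.** Let $c_2>0$, let $\sigma_m^2=c_2d^\beta$, and for $t>0$ let $I=\lceil t\sqrt d\rceil$. 1. For every $c_3\in[0,2]$ there is a constant $c_5>0$, depending only on $c_2,c_3$, such that for all $t>0$, $\beta<-\frac12$ and $\varepsilon>0$, as $d\to\infty$ through odd integers, uniformly in the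 starting point $p_1$, $$\mathbf E^{p_1}\Big[\prod_{1\le k\le I}\big(1-c_3\mathbf 1_{p_k=\frac{d-1}{2}}\big)\Big]\le 1-(1-\varepsilon)\frac{c_3\,t}{\sqrt d}\,(1+g_d+h_d),$$ where $g_d=\mathcal O\big(d^{3/2}e^{-\frac{\pi\varepsilon t}{2c_2}d^{-1/2-\beta}}\big)$, $h_d=\mathcal O\big(e^{-c_5d^{||\beta|-1|}}\big)$ and $h_d=o(1)$. 2. For all $t>0$, $\beta<-\frac12$, $c_1>0$ and $-1<\alpha<1$, with $\xi^2=c_1d^\alpha$, as $d\to\infty$ through odd integers, $$\left|\left\langle\exp\left(\frac{2\pi i\,\widetilde\xi_I}{\sqrt d}\right)\right\rangle\right|\le 1-\frac{t}{\sqrt d}\,(1+o(1)),$$ uniformly in $n_0\in\mathbb Z$ and in the total number $J\ge I$ of measurements. -/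

import Mathlib

open Filter Topology Asymptotics

namespace QuasiIdealClock

noncomputable section

/-- The Jacobi function `θ₃(z, i s) = ∑_{m ∈ ℤ} exp(-π s m² + 2 π i m z)` for real `z` and `s > 0`,
as a real number (see `theta3_eq`). -/
def theta3 (z s : ℝ) : ℝ := (jacobiTheta₂ (z : ℂ) (Complex.I * (s : ℂ))).re

/-- For real arguments the theta function is real, so taking the real part loses nothing. -/
theorem theta3_eq (z s : ℝ) :
    (theta3 z s : ℂ) = jacobiTheta₂ (z : ℂ) (Complex.I * (s : ℂ)) := by
  have h : (starRingEnd ℂ) (jacobiTheta₂ (z : ℂ) (Complex.I * (s : ℂ)))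
      = jacobiTheta₂ (z : ℂ) (Complex.I * (s : ℂ)) := by
    rw [jacobiTheta₂_conj]
    simp
  exact Complex.conj_eq_iff_re.mp h

/-- The labels `-(d-1)/2, …, (d-1)/2` of the energy basis and of the time basis (`d` odd). -/
abbrev Idx (d : ℕ) : Type :=
  {n : ℤ // n ∈ Finset.Icc (-(((d : ℤ) - 1) / 2)) (((d : ℤ) - 1) / 2)}

/-- Coordinates of the time eigenstate `|θ_k⟩ = d^{-1/2} ∑_n e^{-2πikn/d} |n⟩` in the energy
basis. Vectors and matrices below are always written in the energy basis `|n⟩`. -/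
def timeState (d : ℕ) (k : Idx d) : Idx d → ℂ := fun n =>
  (1 / (Real.sqrt d : ℂ)) *
    Complex.exp (-(2 * Real.pi * Complex.I * ((k : ℤ) : ℂ) * ((n : ℤ) : ℂ) / (d : ℂ)))

/-- The Hamiltonian `(2π/√d) ∑_n n |n⟩⟨n|`. -/
def hamiltonian (d : ℕ) : Matrix (Idx d) (Idx d) ℂ :=
  Matrix.diagonal fun n => ((2 * Real.pi / Real.sqrt d * ((n : ℤ) : ℝ) : ℝ) : ℂ)

/-- The free evolution `exp(-i τ H)` during the time `τ`. -/
def evolution (d : ℕ) (τ : ℝ) : Matrix (Idx d) (Idx d) ℂ :=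
  NormedSpace.exp ((-(Complex.I * (τ : ℂ))) • hamiltonian d)

/-- The amplitude `ψ(k) = 𝒩 θ₃(k/d, i ξ²/d) e^{2πi n₀ k/d}` of the quasi-ideal state of squared
width `ξ² = ξsq` and mean energy label `n₀`, with
`𝒩 = √(2/d) / √(θ₃(0, iξ²/(2d)) θ₃(0, idξ²/2) + θ₃(1/2, iξ²/(2d)) θ₃(d/2, idξ²/2))`. -/
def amplitude (d : ℕ) (ξsq : ℝ) (n₀ : ℤ) (k : Idx d) : ℂ :=
  ((Real.sqrt (2 / d) /
      Real.sqrt (theta3 0 (ξsq / (2 * d)) * theta3 0 (d * ξsq / 2)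
        + theta3 (1 / 2) (ξsq / (2 * d)) * theta3 (d / 2) (d * ξsq / 2))
    * theta3 (((k : ℤ) : ℝ) / d) (ξsq / d) : ℝ) : ℂ)
  * Complex.exp (2 * Real.pi * Complex.I * (n₀ : ℂ) * ((k : ℤ) : ℂ) / (d : ℂ))

/-- The initial state `|Ψ₀⟩ = ∑_k ψ(k) |θ_k⟩`. -/
def initialState (d : ℕ) (ξsq : ℝ) (n₀ : ℤ) : Idx d → ℂ :=
  ∑ k : Idx d, amplitude d ξsq n₀ k • timeState d k

/-- The coefficient `Ω_k(x) = d^{-1/4} θ₃(0, 2iσ²/d)^{-1/2} θ₃((k - x√d)/d, iσ²/d)` of the Kraus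
operator, where `σ² = σsq`. -/
def krausCoeff (d : ℕ) (σsq : ℝ) (x : ℝ) (k : Idx d) : ℝ :=
  1 / Real.sqrt (theta3 0 (2 * σsq / d)) * (1 / (d : ℝ) ^ (1 / 4 : ℝ))
    * theta3 ((((k : ℤ) : ℝ) - x * Real.sqrt d) / d) (σsq / d)

/-- The Kraus operator `Ω(x) = ∑_k Ω_k(x) |θ_k⟩⟨θ_k|` for the outcome `x`. -/
def kraus (d : ℕ) (σsq : ℝ) (x : ℝ) : Matrix (Idx d) (Idx d) ℂ :=
  ∑ k : Idx d, (krausCoeff d σsq x k : ℂ) •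
    Matrix.vecMulVec (timeState d k) (star (timeState d k))

/-- The unnormalised state `Ω(x_J) U ⋯ Ω(x_1) U |Ψ₀⟩` after `J` measurements with outcomes
`x_1, …, x_J`, where `U` is the evolution during the time `δ/√d`. -/
def postState (d : ℕ) (ξsq σsq δ : ℝ) (n₀ : ℤ) : (J : ℕ) → (Fin J → ℝ) → (Idx d → ℂ)
  | 0, _ => initialState d ξsq n₀
  | J + 1, x =>
      (kraus d σsq (x (Fin.last J))).mulVec
        ((evolution d (δ / Real.sqrt d)).mulVec
          (postState d ξsq σsq δ n₀ J (fun j => x j.castSucc)))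

/-- The joint density of the outcomes of `J` measurements on `[-√d/2, √d/2]^J`. -/
def outcomeDensity (d : ℕ) (ξsq σsq δ : ℝ) (n₀ : ℤ) (J : ℕ) (x : Fin J → ℝ) : ℝ :=
  ‖WithLp.toLp 2 (postState d ξsq σsq δ n₀ J x)‖ ^ 2

/-- The expectation `⟨exp(2πi x_i/√d)⟩` for the `i`-th outcome in a sequence of `J` measurements. -/
def outcomeCharacter (d : ℕ) (ξsq σsq δ : ℝ) (n₀ : ℤ) (J : ℕ) (i : Fin J) : ℂ :=
  ∫ x in Set.pi Set.univ
      (fun _ : Fin J => Set.Icc (-(Real.sqrt d / 2)) (Real.sqrt d / 2)),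
    Complex.exp (2 * Real.pi * Complex.I * (x i : ℂ) / (Real.sqrt d : ℂ))
      * (outcomeDensity d ξsq σsq δ n₀ J x : ℂ)

/-- The jump distribution `q ↦ θ₃(q/d, i/(2σ²d)) / (√(2σ²d) θ₃(0, 2iσ²/d))` of the random walk
on the ring of integers modulo `d`. -/
def jumpProb (d : ℕ) (σsq : ℝ) (q : ℤ) : ℝ :=
  theta3 ((q : ℝ) / d) (1 / (2 * σsq * d)) /
    (Real.sqrt (2 * σsq * d) * theta3 0 (2 * σsq / d))

/-- The expectation `E^{p₁}[F(p_1, …, p_{n+1})]` for the walk with `n` jumps started at `p₁`;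
the positions `p_1, …, p_{n+1}` are `p 0, …, p n`. -/
def walkExpectation (d : ℕ) (σsq : ℝ) (n : ℕ) (p₁ : Idx d)
    (F : (Fin (n + 1) → Idx d) → ℝ) : ℝ :=
  ∑ p : Fin (n + 1) → Idx d,
    if p 0 = p₁ then
      (∏ j : Fin n, jumpProb d σsq ((p j.succ : ℤ) - (p j.castSucc : ℤ))) * F p
    else 0

/-- The random variable `∏_j (1 - c 1_{p_j = (d-1)/2})`. -/
def antipodeProduct (d : ℕ) (c : ℝ) (n : ℕ) (p : Fin (n + 1) → Idx d) : ℝ :=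
  ∏ j : Fin (n + 1), (1 - c * (if (p j : ℤ) = ((d : ℤ) - 1) / 2 then 1 else 0))

end

end QuasiIdealClock

/-! Both parts reduce to one estimate for the random walk on the energy labels modulo `d`.

From quantum to walk. Expanding the theta function of a Kraus operator as a series writes it, in the
energy basis, as a superposition of cyclic shifts with Gaussian weights. Integrating over an unread
outcome kills the cross terms, because the phases are orthogonal on the outcome interval, and the
squared weights, reduced modulo `d`, are the jump law of the walk. So, in the Heisenberg picture,
with `S` the cyclic shift, an unread measurement sends `S^a G` (`G` diagonal) to `S^a (P G)`, where
`P` is the transition operator (`integral_shiftForm_kraus`). If the last outcome is weighted by its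
character, the two shifts must differ by one, and the identity becomes a scalar of modulus at most 1
times `S`. Free evolution with `δ = 1/2` conjugates `S` to a constant phase times `S`, with an extra
sign `-1` at the label where `S` wraps around (`shiftForm_one_evolution`). Up to a factor of modulus
at most 1, the outcome character is therefore `⟨Ψ₀, S f Ψ₀⟩`, where `f p` is the expectation of the
product of the signs along the walk from `p`. It is at most `sup |f|` since the initial state is
normalised, which also gives uniformity in `n₀`. Later measurements preserve the norm on average.

The walk. The characters diagonalise `P`, and Poisson summation bounds its nontrivial eigenvalues by
`exp (-x / 2)` with `x = π / (2σ²d)`, of order `d ^ (-1 - β)`. Since `β < -1/2`, the walk is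
equidistributed after a small fraction of the `t√d` steps, so the expected number of visits of the
last label is at least `(1 - ε) t / √d` (`eventually_le_laterVisits`). A sup bound on the jump law
shows that this number also tends to zero uniformly in the start, so multiple visits are negligible;
a Bonferroni argument (`walkValue_bounds`) turns visits into the product.

For fixed `ε` all corrections are eventually absorbed into `ε`, so no error terms remain. In the
second part the sign product corresponds to `c = 2`, while only the decrement `t / √d` is required;
this factor of two leaves room to take the error term equal to zero. -/

namespace QuasiIdealClock

/-! ### Characters, Gaussian weights and Poisson summation for the real theta function. -/

/-- The character `x ↦ e^{2πix}` of the real line. -/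
noncomputable def charExp (x : ℝ) : ℂ := Complex.exp (2 * Real.pi * Complex.I * x)

theorem charExp_add (x y : ℝ) : charExp (x + y) = charExp x * charExp y := by
  simp only [charExp, ← Complex.exp_add]
  push_cast
  ring_nf

@[simp] theorem charExp_zero : charExp 0 = 1 := by simp [charExp]

@[simp] theorem charExp_int (n : ℤ) : charExp n = 1 := by
  rw [charExp, Complex.exp_eq_one_iff]
  exact ⟨n, by push_cast; ring⟩

theorem charExp_add_int (x : ℝ) (n : ℤ) : charExp (x + n) = charExp x := by
  rw [charExp_add, charExp_int, mul_one]

@[simp] theorem norm_charExp (x : ℝ) : ‖charExp x‖ = 1 := by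
  rw [charExp, show (2 * Real.pi * Complex.I * x : ℂ) = ((2 * Real.pi * x : ℝ) : ℂ) * Complex.I by
    push_cast; ring, Complex.norm_exp_ofReal_mul_I]

theorem conj_charExp (x : ℝ) : (starRingEnd ℂ) (charExp x) = charExp (-x) := by
  rw [charExp, charExp, ← Complex.exp_conj]
  congr 1
  simp [map_ofNat]

theorem charExp_neg_mul_self (x : ℝ) : charExp (-x) * charExp x = 1 := by
  rw [← charExp_add]; simp

@[fun_prop]
theorem continuous_charExp : Continuous charExp := by
  unfold charExp
  fun_prop

theorem charExp_eq_one_iff (x : ℝ) : charExp x = 1 ↔ ∃ n : ℤ, x = n := by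
  rw [charExp, Complex.exp_eq_one_iff]
  constructor
  · rintro ⟨n, hn⟩
    refine ⟨n, ?_⟩
    have h : (2 * Real.pi * Complex.I : ℂ) ≠ 0 := Complex.two_pi_I_ne_zero
    have h2 : (2 * Real.pi * Complex.I : ℂ) * x = (2 * Real.pi * Complex.I : ℂ) * n := by
      rw [hn]; ring
    exact_mod_cast mul_left_cancel₀ h h2
  · rintro ⟨n, rfl⟩
    exact ⟨n, by push_cast; ring⟩

/-- The Gaussian weight `exp(-π s m²)`. -/
noncomputable def gaussWeight (s : ℝ) (m : ℤ) : ℝ := Real.exp (-(Real.pi * s * (m : ℝ) ^ 2))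

theorem gaussWeight_pos (s : ℝ) (m : ℤ) : 0 < gaussWeight s m := Real.exp_pos _

theorem gaussWeight_sq (s : ℝ) (m : ℤ) : gaussWeight s m ^ 2 = gaussWeight (2 * s) m := by
  rw [gaussWeight, gaussWeight, ← Real.exp_nat_mul]
  congr 1
  push_cast; ring

theorem jacobiTheta₂_term_eq (z s : ℝ) (m : ℤ) :
    jacobiTheta₂_term m (z : ℂ) (Complex.I * (s : ℂ)) = gaussWeight s m * charExp (m * z) := by
  rw [jacobiTheta₂_term, gaussWeight, charExp, Complex.ofReal_exp, ← Complex.exp_add]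
  congr 1
  push_cast
  ring_nf
  rw [Complex.I_sq]
  ring

theorem hasSum_theta3 {s : ℝ} (hs : 0 < s) (z : ℝ) :
    HasSum (fun m : ℤ => (gaussWeight s m : ℂ) * charExp (m * z)) (theta3 z s) := by
  rw [theta3_eq]
  simpa only [jacobiTheta₂_term_eq] using
    hasSum_jacobiTheta₂_term (z : ℂ) (τ := Complex.I * s) (by simpa using hs)

theorem hasSum_theta3_zero {s : ℝ} (hs : 0 < s) : HasSum (gaussWeight s) (theta3 0 s) := by
  have h := hasSum_theta3 hs 0
  simp only [mul_zero, charExp_zero, mul_one] at h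
  exact_mod_cast h

theorem summable_gaussWeight {s : ℝ} (hs : 0 < s) : Summable (gaussWeight s) :=
  (hasSum_theta3_zero hs).summable

theorem one_le_theta3_zero {s : ℝ} (hs : 0 < s) : 1 ≤ theta3 0 s := by
  have h := (hasSum_theta3_zero hs).summable.le_tsum 0 (fun j _ => (gaussWeight_pos s j).le)
  rw [(hasSum_theta3_zero hs).tsum_eq] at h
  simpa [gaussWeight] using h

theorem theta3_le_theta3_zero {s : ℝ} (hs : 0 < s) (z : ℝ) : theta3 z s ≤ theta3 0 s := by
  have h1 := (hasSum_theta3 hs z)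
  have h2 : ‖(theta3 z s : ℂ)‖ ≤ theta3 0 s := by
    rw [← h1.tsum_eq, ← (hasSum_theta3_zero hs).tsum_eq]
    refine (norm_tsum_le_tsum_norm ?_).trans (le_of_eq ?_)
    · simpa [abs_of_pos (gaussWeight_pos s _)] using summable_gaussWeight hs
    · simp [abs_of_pos (gaussWeight_pos s _)]
  rw [Complex.norm_real] at h2
  exact (le_abs_self _).trans h2

/-- Poisson summation for `θ₃`. -/
theorem hasSum_theta3_poisson {s : ℝ} (hs : 0 < s) (z : ℝ) :
    HasSum (fun j : ℤ => Real.exp (-(Real.pi * (z + j) ^ 2 / s))) (Real.sqrt s * theta3 z s) := by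
  have hs' : (s : ℂ) ≠ 0 := by exact_mod_cast hs.ne'
  have him : 0 < (-1 / (Complex.I * s) : ℂ).im := by
    have : (-1 / (Complex.I * s) : ℂ) = ((1 / s : ℝ) : ℂ) * Complex.I := by
      push_cast
      field_simp
      simp
    rw [this]
    simpa using hs
  have h1 := hasSum_jacobiTheta₂_term ((z : ℂ) / (Complex.I * s)) him
  have h2 := h1.mul_left (Complex.exp (-(Real.pi * z ^ 2 / s)))
  have h3 := jacobiTheta₂_functional_equation (z : ℂ) (Complex.I * s)
  have h4 : (-Complex.I * (Complex.I * s) : ℂ) = s := by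
    rw [← mul_assoc, neg_mul, Complex.I_mul_I]; ring
  have h5 : (s : ℂ) ^ (1 / 2 : ℂ) = (Real.sqrt s : ℂ) := by
    rw [Real.sqrt_eq_rpow, Complex.ofReal_cpow hs.le]
    norm_num
  have h6 : (-Real.pi * Complex.I * (z : ℂ) ^ 2 / (Complex.I * s) : ℂ) = -(Real.pi * z ^ 2 / s) := by
    field_simp
  rw [h4, h5, h6, ← theta3_eq] at h3
  have hq : (Real.sqrt s : ℂ) ≠ 0 := by exact_mod_cast (Real.sqrt_pos.mpr hs).ne'
  have h7 : Complex.exp (-(Real.pi * z ^ 2 / s)) *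
      jacobiTheta₂ ((z : ℂ) / (Complex.I * s)) (-1 / (Complex.I * s))
      = ((Real.sqrt s * theta3 z s : ℝ) : ℂ) := by
    push_cast
    rw [h3]
    field_simp
  -- Completing the square in the transformed series gives `(z - j)²`; the reflection of `j` turns
  -- it into `(z + j)²`.
  rw [h7, ← (Equiv.neg ℤ).hasSum_iff] at h2
  rw [← Complex.hasSum_ofReal]
  refine h2.congr_fun fun j => ?_
  simp only [Function.comp, Equiv.neg_apply, jacobiTheta₂_term]
  rw [← Complex.exp_add, Complex.ofReal_exp]
  congr 1
  push_cast
  field_simp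
  ring

theorem theta3_pos {s : ℝ} (hs : 0 < s) (z : ℝ) : 0 < theta3 z s := by
  have h := hasSum_theta3_poisson hs z
  have h2 : 0 < Real.sqrt s * theta3 z s := by
    rw [← h.tsum_eq]
    exact h.summable.tsum_pos (fun j => (Real.exp_pos _).le) 0 (Real.exp_pos _)
  exact pos_of_mul_pos_right h2 (Real.sqrt_nonneg _)

theorem sqrt_mul_theta3_zero {s : ℝ} (hs : 0 < s) :
    Real.sqrt s * theta3 0 s = theta3 0 (1 / s) := by
  have h := hasSum_theta3_poisson hs 0
  refine h.unique ?_
  convert hasSum_theta3_zero (one_div_pos.mpr hs) using 2 with j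
  simp only [gaussWeight]
  congr 1
  ring

theorem theta3_zero_antitone {s t : ℝ} (hs : 0 < s) (hst : s ≤ t) : theta3 0 t ≤ theta3 0 s := by
  refine hasSum_le (fun j => ?_) (hasSum_theta3_zero (hs.trans_le hst)) (hasSum_theta3_zero hs)
  simp only [gaussWeight]
  gcongr

/-- For `s ≤ 1` this is monotonicity; for `s ≥ 1` the modular transformation produces the factor
`√s` and monotonicity bounds the rest. -/
theorem theta3_zero_one_div_le {s : ℝ} (hs : 0 < s) :
    theta3 0 (1 / s) ≤ theta3 0 1 * (1 + Real.sqrt s) := by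
  have hK := one_le_theta3_zero one_pos
  rcases le_total s 1 with h | h
  · have := theta3_zero_antitone one_pos (one_le_one_div hs h)
    nlinarith [Real.sqrt_nonneg s]
  · rw [← sqrt_mul_theta3_zero hs]
    have := theta3_zero_antitone one_pos h
    nlinarith [Real.sqrt_nonneg s]

@[fun_prop]
theorem continuous_theta3 {s : ℝ} (hs : 0 < s) : Continuous (fun z => theta3 z s) := by
  refine Complex.continuous_re.comp (continuous_iff_continuousAt.mpr fun z => ?_)
  exact (differentiableAt_jacobiTheta₂_fst (z : ℂ) (τ := Complex.I * s)
    (by simpa using hs)).continuousAt.comp Complex.continuous_ofReal.continuousAt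

end QuasiIdealClock
-- Arithmetic of labels modulo `d` and orthogonality of characters.
namespace QuasiIdealClock

variable {d : ℕ}

theorem mem_idx_iff (hd : Odd d) (n : ℤ) :
    n ∈ Finset.Icc (-(((d : ℤ) - 1) / 2)) (((d : ℤ) - 1) / 2) ↔
      0 ≤ n + ((d : ℤ) - 1) / 2 ∧ n + ((d : ℤ) - 1) / 2 < d := by
  obtain ⟨e, rfl⟩ := hd
  rw [Finset.mem_Icc]
  push_cast
  omega

/-- The label congruent to `n` modulo `d`. -/
def wrap (hd : Odd d) (n : ℤ) : Idx d :=
  ⟨(n + ((d : ℤ) - 1) / 2) % d - ((d : ℤ) - 1) / 2, by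
    have h : (0 : ℤ) < d := by exact_mod_cast hd.pos
    rw [mem_idx_iff hd]
    constructor
    · have := Int.emod_nonneg (n + ((d : ℤ) - 1) / 2) h.ne'
      omega
    · have := Int.emod_lt_of_pos (n + ((d : ℤ) - 1) / 2) h
      omega⟩

theorem wrap_coe (hd : Odd d) (p : Idx d) : wrap hd (p : ℤ) = p := by
  have h := (mem_idx_iff hd p).mp p.2
  apply Subtype.ext
  simp only [wrap]
  rw [Int.emod_eq_of_lt h.1 h.2]
  ring

theorem wrap_eq_wrap_iff (hd : Odd d) (m n : ℤ) : wrap hd m = wrap hd n ↔ (d : ℤ) ∣ m - n := by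
  rw [Subtype.ext_iff]
  simp only [wrap]
  rw [sub_left_inj, Int.emod_eq_emod_iff_emod_sub_eq_zero, Int.dvd_iff_emod_eq_zero]
  ring_nf

theorem dvd_wrap_sub (hd : Odd d) (n : ℤ) : (d : ℤ) ∣ (wrap hd n : ℤ) - n := by
  rw [← wrap_eq_wrap_iff hd, wrap_coe]

theorem wrap_wrap_add (hd : Odd d) (m n : ℤ) :
    wrap hd ((wrap hd m : ℤ) + n) = wrap hd (m + n) := by
  rw [wrap_eq_wrap_iff]
  have := dvd_wrap_sub hd m
  rwa [show (wrap hd m : ℤ) + n - (m + n) = (wrap hd m : ℤ) - m by ring]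

/-- The cyclic shift of the labels by `m`. -/
def shiftEquiv (hd : Odd d) (m : ℤ) : Idx d ≃ Idx d where
  toFun p := wrap hd (p + m)
  invFun p := wrap hd (p + -m)
  left_inv p := by simp [wrap_wrap_add, wrap_coe]
  right_inv p := by simp [wrap_wrap_add, wrap_coe]

@[simp] theorem shiftEquiv_apply (hd : Odd d) (m : ℤ) (p : Idx d) :
    shiftEquiv hd m p = wrap hd (p + m) := rfl

theorem charExp_div_congr (hd : Odd d) {m n : ℤ} (h : (d : ℤ) ∣ m - n) :
    charExp ((m : ℝ) / d) = charExp ((n : ℝ) / d) := by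
  obtain ⟨j, hj⟩ := h
  have h0 : (d : ℝ) ≠ 0 := by exact_mod_cast hd.pos.ne'
  have hm : (m : ℝ) = n + d * j := by
    have : m = n + d * j := by linarith
    rw [this]; push_cast; ring
  rw [hm, add_div, mul_div_cancel_left₀ _ h0, charExp_add_int]

theorem charExp_wrap (hd : Odd d) (m n : ℤ) :
    charExp ((m : ℝ) * ((wrap hd n : ℤ) : ℝ) / d) = charExp ((m : ℝ) * n / d) := by
  have := charExp_div_congr hd (m := m * (wrap hd n : ℤ)) (n := m * n)
    (by rw [← mul_sub]; exact (dvd_wrap_sub hd n).mul_left m)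
  push_cast at this
  exact this

theorem card_idx (hd : Odd d) : Fintype.card (Idx d) = d := by
  rw [Fintype.card_coe, Int.card_Icc]
  obtain ⟨e, rfl⟩ := hd
  push_cast
  omega

theorem charExp_div_eq_one_iff (hd : Odd d) (r : ℤ) :
    charExp ((r : ℝ) / d) = 1 ↔ (d : ℤ) ∣ r := by
  have h0 : (d : ℝ) ≠ 0 := by exact_mod_cast hd.pos.ne'
  rw [charExp_eq_one_iff]
  constructor
  · rintro ⟨n, hn⟩
    refine ⟨n, ?_⟩
    rw [div_eq_iff h0] at hn
    have : (r : ℝ) = ((d * n : ℤ) : ℝ) := by rw [hn]; push_cast; ring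
    exact_mod_cast this
  · rintro ⟨n, rfl⟩
    exact ⟨n, by push_cast; field_simp⟩

/-- Orthogonality of the characters of the integers modulo `d`. -/
theorem sum_charExp (hd : Odd d) (r : ℤ) :
    ∑ k : Idx d, charExp ((r : ℝ) * ((k : ℤ) : ℝ) / d) = if (d : ℤ) ∣ r then (d : ℂ) else 0 := by
  split_ifs with h
  · have : ∀ k : Idx d, charExp ((r : ℝ) * ((k : ℤ) : ℝ) / d) = 1 := fun k => by
      have := (charExp_div_eq_one_iff hd (r * k)).mpr (h.mul_right _)
      push_cast at this
      exact this
    rw [Finset.sum_congr rfl fun k _ => this k, Finset.sum_const, Finset.card_univ, card_idx hd]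
    simp
  -- Shifting the summation label by one multiplies the sum by `charExp (r / d) ≠ 1`, so the sum
  -- vanishes.
  · have h1 := (shiftEquiv hd 1).sum_comp
      (fun k : Idx d => charExp ((r : ℝ) * ((k : ℤ) : ℝ) / d))
    simp only [shiftEquiv_apply, charExp_wrap] at h1
    have h2 : ∀ k : Idx d, charExp ((r : ℝ) * (((k : ℤ) + 1 : ℤ) : ℝ) / d)
        = charExp ((r : ℝ) / d) * charExp ((r : ℝ) * ((k : ℤ) : ℝ) / d) := fun k => by
      rw [← charExp_add]
      congr 1
      push_cast
      ring
    simp only [h2, ← Finset.mul_sum] at h1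
    have h3 : charExp ((r : ℝ) / d) ≠ 1 := fun h' => h ((charExp_div_eq_one_iff hd r).mp h')
    by_contra h4
    exact h3 (mul_right_cancel₀ h4 (h1.trans (one_mul _).symm))

theorem sum_charExp_sub (hd : Odd d) (p q : Idx d) :
    ∑ k : Idx d, charExp (((k : ℤ) : ℝ) * (((p : ℤ) : ℝ) - ((q : ℤ) : ℝ)) / d)
      = if p = q then (d : ℂ) else 0 := by
  have h := sum_charExp hd ((p : ℤ) - (q : ℤ))
  simp only [← wrap_eq_wrap_iff hd, wrap_coe] at h
  rw [← h]
  refine Finset.sum_congr rfl fun k _ => ?_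
  push_cast
  rw [mul_comm]

/-- Summation over the integers by residue classes. -/
theorem hasSum_mul_wrap {R : Type*} [Ring R] [TopologicalSpace R] [IsTopologicalRing R]
    (hd : Odd d) {b B : ℤ → R} (hB : ∀ q : ℤ, HasSum (fun j : ℤ => b (q + d * j)) (B q))
    (G : Idx d → R) (p : ℤ) :
    HasSum (fun n : ℤ => b n * G (wrap hd (p + n))) (∑ p' : Idx d, B ((p' : ℤ) - p) * G p') := by
  have h0 : (d : ℤ) ≠ 0 := by exact_mod_cast hd.pos.ne'
  have key : ∀ p' : Idx d, HasSum
      (fun n : ℤ => if wrap hd (p + n) = p' then b n * G p' else 0)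
      (B ((p' : ℤ) - p) * G p') := fun p' => by
    have hinj : Function.Injective (fun j : ℤ => (p' : ℤ) - p + d * j) := fun i j hij =>
      mul_left_cancel₀ h0 (add_left_cancel hij)
    rw [← hinj.hasSum_iff]
    · refine ((hB ((p' : ℤ) - p)).mul_right (G p')).congr_fun fun j => ?_
      simp only [Function.comp]
      rw [if_pos]
      rw [← wrap_coe hd p', wrap_eq_wrap_iff, wrap_coe]
      exact ⟨j, by ring⟩
    · intro n hn
      rw [if_neg]
      intro h
      apply hn
      rw [← wrap_coe hd p', wrap_eq_wrap_iff] at h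
      obtain ⟨j, hj⟩ := h
      exact ⟨j, by simp only; linarith⟩
  refine (hasSum_sum fun p' _ => key p').congr_fun fun n => ?_
  simp

/-! ### The random walk, its spectrum and its expected visits. -/

/-- The normalised Gaussian weights on the integers whose reduction modulo `d` is the jump
distribution. -/
theorem hasSum_jumpProb (hd : Odd d) {σsq : ℝ} (hσ : 0 < σsq) (q : ℤ) :
    HasSum (fun j : ℤ => 1 / theta3 0 (2 * σsq / d) * gaussWeight (2 * σsq / d) (q + d * j))
      (jumpProb d σsq q) := by
  have h0 : (0 : ℝ) < d := by exact_mod_cast hd.pos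
  have hs : 0 < 1 / (2 * σsq * d) := by positivity
  have h := (hasSum_theta3_poisson hs ((q : ℝ) / d)).mul_left (1 / theta3 0 (2 * σsq / d))
  have h2 : 1 / theta3 0 (2 * σsq / d) *
      (Real.sqrt (1 / (2 * σsq * d)) * theta3 ((q : ℝ) / d) (1 / (2 * σsq * d)))
      = jumpProb d σsq q := by
    rw [jumpProb, Real.sqrt_div zero_le_one, Real.sqrt_one]
    ring
  rw [h2] at h
  refine h.congr_fun fun j => ?_
  simp only [gaussWeight]
  congr 2
  push_cast
  field_simp

theorem jumpProb_nonneg (hd : Odd d) {σsq : ℝ} (hσ : 0 < σsq) (q : ℤ) : 0 ≤ jumpProb d σsq q := by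
  have h0 : (0 : ℝ) < d := by exact_mod_cast hd.pos
  exact (div_pos (theta3_pos (by positivity) _)
    (mul_pos (by positivity) (theta3_pos (by positivity) _))).le

/-- The theta quotient is largest at zero, and the modular transformation bounds its denominator
below by `d`. This sup bound is what makes revisits rare. -/
theorem jumpProb_le (hd : Odd d) {σsq : ℝ} (hσ : 0 < σsq) (q : ℤ) :
    jumpProb d σsq q ≤ theta3 0 1 * (1 + Real.sqrt (2 * σsq * d)) / d := by
  have h0 : (0 : ℝ) < d := by exact_mod_cast hd.pos
  have hs : 0 < 2 * σsq * d := by positivity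
  have h1 : (d : ℝ) ≤ Real.sqrt (2 * σsq * d) * theta3 0 (2 * σsq / d) := by
    have h2 : 0 < 2 * σsq / d := by positivity
    have h3 := sqrt_mul_theta3_zero h2
    have h4 := one_le_theta3_zero (one_div_pos.mpr h2)
    have h5 : Real.sqrt (2 * σsq * d) = d * Real.sqrt (2 * σsq / d) := by
      rw [← Real.sqrt_sq h0.le, ← Real.sqrt_mul (sq_nonneg _), Real.sqrt_sq h0.le]
      congr 1
      field_simp
    rw [h5, mul_assoc, h3]
    nlinarith
  have h6 := (theta3_le_theta3_zero (one_div_pos.mpr hs) ((q : ℝ) / d)).trans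
    (theta3_zero_one_div_le hs)
  have h7 := (theta3_pos (one_div_pos.mpr hs) ((q : ℝ) / d)).le
  rw [jumpProb]
  exact div_le_div₀ (h7.trans h6) h6 h0 h1

/-- The transition operator of the random walk. -/
noncomputable def transition (d : ℕ) (σsq : ℝ) (f : Idx d → ℝ) : Idx d → ℝ := fun p =>
  ∑ p' : Idx d, jumpProb d σsq ((p' : ℤ) - (p : ℤ)) * f p'

theorem hasSum_transition (hd : Odd d) {σsq : ℝ} (hσ : 0 < σsq) (f : Idx d → ℝ) (p : Idx d) :
    HasSum (fun n : ℤ => 1 / theta3 0 (2 * σsq / d) * gaussWeight (2 * σsq / d) n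
      * f (wrap hd (p + n))) (transition d σsq f p) :=
  hasSum_mul_wrap hd (b := fun n => 1 / theta3 0 (2 * σsq / d) * gaussWeight (2 * σsq / d) n)
    (B := jumpProb d σsq) (fun q => hasSum_jumpProb hd hσ q) f p

theorem sum_jumpProb (hd : Odd d) {σsq : ℝ} (hσ : 0 < σsq) (p : Idx d) :
    ∑ p' : Idx d, jumpProb d σsq ((p' : ℤ) - (p : ℤ)) = 1 := by
  have h0 : (0 : ℝ) < d := by exact_mod_cast hd.pos
  have hs : 0 < 2 * σsq / d := by positivity
  have h := hasSum_transition hd hσ (fun _ => 1) p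
  simp only [transition, mul_one] at h
  have h2 := (hasSum_theta3_zero hs).mul_left (1 / theta3 0 (2 * σsq / d))
  rw [one_div_mul_cancel (theta3_pos hs 0).ne'] at h2
  exact h.unique h2

theorem transition_const (hd : Odd d) {σsq : ℝ} (hσ : 0 < σsq) (c : ℝ) (p : Idx d) :
    transition d σsq (fun _ => c) p = c := by
  rw [transition, ← Finset.sum_mul, sum_jumpProb hd hσ, one_mul]

theorem transition_mono (hd : Odd d) {σsq : ℝ} (hσ : 0 < σsq) {f g : Idx d → ℝ}
    (h : ∀ p, f p ≤ g p) (p : Idx d) : transition d σsq f p ≤ transition d σsq g p :=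
  Finset.sum_le_sum fun p' _ => mul_le_mul_of_nonneg_left (h p') (jumpProb_nonneg hd hσ _)

theorem transition_affine (hd : Odd d) {σsq : ℝ} (hσ : 0 < σsq) (x y : ℝ) (f : Idx d → ℝ)
    (p : Idx d) :
    transition d σsq (fun q => x + y * f q) p = x + y * transition d σsq f p := by
  simp only [transition, mul_add, Finset.sum_add_distrib, ← Finset.sum_mul, sum_jumpProb hd hσ,
    one_mul, Finset.mul_sum]
  congr 1
  refine Finset.sum_congr rfl fun p' _ => ?_
  ring

/-- The eigenvalues of the transition operator. -/
noncomputable def eigenvalue (d : ℕ) (σsq : ℝ) (m : ℤ) : ℝ :=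
  theta3 ((m : ℝ) / d) (2 * σsq / d) / theta3 0 (2 * σsq / d)

/-- Translation-invariant kernels are diagonal in the characters. Unfolding the jump law to Gaussian
weights on all integers makes the eigenvalue a theta series. -/
theorem sum_jumpProb_mul_charExp (hd : Odd d) {σsq : ℝ} (hσ : 0 < σsq) (m : ℤ) (p : Idx d) :
    ∑ p' : Idx d, (jumpProb d σsq ((p' : ℤ) - (p : ℤ)) : ℂ)
        * charExp ((m : ℝ) * ((p' : ℤ) : ℝ) / d)
      = eigenvalue d σsq m * charExp ((m : ℝ) * ((p : ℤ) : ℝ) / d) := by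
  have h0 : (0 : ℝ) < d := by exact_mod_cast hd.pos
  have hs : 0 < 2 * σsq / d := by positivity
  have h1 : ∀ q : ℤ, HasSum (fun j : ℤ => ((1 / theta3 0 (2 * σsq / d)
      * gaussWeight (2 * σsq / d) (q + d * j) : ℝ) : ℂ)) (jumpProb d σsq q : ℂ) :=
    fun q => Complex.hasSum_ofReal.mpr (hasSum_jumpProb hd hσ q)
  have h := hasSum_mul_wrap hd (b := fun n => ((1 / theta3 0 (2 * σsq / d)
      * gaussWeight (2 * σsq / d) n : ℝ) : ℂ)) h1
    (fun p' : Idx d => charExp ((m : ℝ) * ((p' : ℤ) : ℝ) / d)) p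
  refine h.unique ?_
  have h2 := (hasSum_theta3 hs ((m : ℝ) / d)).mul_left
    ((1 / theta3 0 (2 * σsq / d) : ℝ) * charExp ((m : ℝ) * ((p : ℤ) : ℝ) / d))
  convert! h2 using 1
  · funext n
    rw [charExp_wrap, show (m : ℝ) * (((p : ℤ) + n : ℤ) : ℝ) / d
      = (m : ℝ) * ((p : ℤ) : ℝ) / d + n * ((m : ℝ) / d) by push_cast; ring, charExp_add]
    push_cast
    ring
  · rw [eigenvalue]
    push_cast
    ring

/-- The `k`-step transition probability to the label `a`. -/
noncomputable def stepProb (d : ℕ) (σsq : ℝ) (a : Idx d) : ℕ → Idx d → ℝ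
  | 0 => fun p => if p = a then 1 else 0
  | k + 1 => transition d σsq (stepProb d σsq a k)

theorem stepProb_eq (hd : Odd d) {σsq : ℝ} (hσ : 0 < σsq) (a : Idx d) (k : ℕ) (p : Idx d) :
    (stepProb d σsq a k p : ℂ) = (1 / d : ℂ) * ∑ m : Idx d, (eigenvalue d σsq m : ℂ) ^ k *
      charExp (((m : ℤ) : ℝ) * (((p : ℤ) : ℝ) - ((a : ℤ) : ℝ)) / d) := by
  have h0 : (d : ℂ) ≠ 0 := by exact_mod_cast hd.pos.ne'
  induction k generalizing p with
  | zero =>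
    simp only [stepProb, pow_zero, one_mul, sum_charExp_sub hd]
    split_ifs <;> simp [h0]
  | succ k ih =>
    simp only [stepProb, transition]
    push_cast
    simp only [ih]
    have : ∀ p' m : Idx d, charExp (((m : ℤ) : ℝ) * (((p' : ℤ) : ℝ) - ((a : ℤ) : ℝ)) / d)
        = charExp (((m : ℤ) : ℝ) * ((p' : ℤ) : ℝ) / d)
          * charExp (-(((m : ℤ) : ℝ) * ((a : ℤ) : ℝ) / d)) := fun p' m => by
      rw [← charExp_add]; congr 1; ring
    simp only [this, Finset.mul_sum]
    rw [Finset.sum_comm]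
    refine Finset.sum_congr rfl fun m _ => ?_
    have hm := sum_jumpProb_mul_charExp hd hσ m p
    calc _ = (1 / d : ℂ) * (eigenvalue d σsq m : ℂ) ^ k
          * charExp (-(((m : ℤ) : ℝ) * ((a : ℤ) : ℝ) / d)) *
          ∑ p' : Idx d, (jumpProb d σsq ((p' : ℤ) - (p : ℤ)) : ℂ)
            * charExp (((m : ℤ) : ℝ) * ((p' : ℤ) : ℝ) / d) := by
          rw [Finset.mul_sum]
          refine Finset.sum_congr rfl fun p' _ => ?_
          ring
      _ = _ := by rw [hm]; ring

theorem eigenvalue_nonneg (hd : Odd d) {σsq : ℝ} (hσ : 0 < σsq) (m : ℤ) :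
    0 ≤ eigenvalue d σsq m := by
  have h0 : (0 : ℝ) < d := by exact_mod_cast hd.pos
  exact (div_pos (theta3_pos (by positivity) _) (theta3_pos (by positivity) _)).le

theorem eigenvalue_zero (hd : Odd d) {σsq : ℝ} (hσ : 0 < σsq) : eigenvalue d σsq 0 = 1 := by
  have h0 : (0 : ℝ) < d := by exact_mod_cast hd.pos
  have hs : 0 < 2 * σsq / d := by positivity
  simp only [eigenvalue, Int.cast_zero, zero_div]
  exact div_self (theta3_pos hs 0).ne'

/-- In the spectral expansion the mode `m = 0` contributes exactly `1 / d`, and each of the other `d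
- 1` modes at least `-(r ^ k) / d`. -/
theorem le_stepProb (hd : Odd d) {σsq r : ℝ} (hσ : 0 < σsq) (a : Idx d) (k : ℕ) (p : Idx d)
    (hr : ∀ m : Idx d, (m : ℤ) ≠ 0 → eigenvalue d σsq m ≤ r) (hr0 : 0 ≤ r) :
    (1 - d * r ^ k) / d ≤ stepProb d σsq a k p := by
  have h0 : (0 : ℝ) < d := by exact_mod_cast hd.pos
  have h := congrArg Complex.re (stepProb_eq hd hσ a k p)
  rw [Complex.ofReal_re, show (1 / d : ℂ) = ((1 / d : ℝ) : ℂ) by push_cast; rfl,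
    Complex.re_ofReal_mul, Complex.re_sum] at h
  rw [h, div_eq_inv_mul, ← one_div]
  refine mul_le_mul_of_nonneg_left ?_ (by positivity)
  rw [← Finset.add_sum_erase _ _ (Finset.mem_univ (wrap hd 0))]
  have hw : ((wrap hd 0 : Idx d) : ℤ) = 0 := by
    simp only [wrap, zero_add]
    rw [Int.emod_eq_of_lt]
    · ring
    · have := hd.pos; omega
    · have := hd.pos; omega
  have h1 : ∀ m ∈ Finset.univ.erase (wrap hd 0), -(r ^ k) ≤ ((eigenvalue d σsq (m : ℤ) : ℂ) ^ k *
      charExp (((m : ℤ) : ℝ) * (((p : ℤ) : ℝ) - ((a : ℤ) : ℝ)) / d)).re := fun m hm => by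
    have hm0 : (m : ℤ) ≠ 0 := fun h' => by
      rw [← hw] at h'
      exact (Finset.mem_erase.mp hm).1 (Subtype.ext h')
    refine (neg_le_neg ?_).trans (neg_le_of_abs_le (Complex.abs_re_le_norm _))
    rw [norm_mul, norm_charExp, mul_one, norm_pow, Complex.norm_real, Real.norm_eq_abs,
      abs_of_nonneg (eigenvalue_nonneg hd hσ _)]
    exact pow_le_pow_left₀ (eigenvalue_nonneg hd hσ _) (hr m hm0) k
  have h2 := Finset.sum_le_sum h1
  rw [Finset.sum_const, Finset.card_erase_of_mem (Finset.mem_univ _), Finset.card_univ,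
    card_idx hd, nsmul_eq_mul, Nat.cast_sub hd.pos] at h2
  rw [hw, eigenvalue_zero hd hσ]
  simp only [Complex.ofReal_one, one_pow, one_mul, Int.cast_zero, zero_mul, zero_div,
    charExp_zero, Complex.one_re]
  have h3 : 0 ≤ r ^ k := pow_nonneg hr0 k
  push_cast at h2
  nlinarith

theorem stepProb_nonneg (hd : Odd d) {σsq : ℝ} (hσ : 0 < σsq) (a : Idx d) (k : ℕ) (p : Idx d) :
    0 ≤ stepProb d σsq a k p := by
  induction k generalizing p with
  | zero => simp only [stepProb]; split_ifs <;> norm_num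
  | succ k ih =>
    rw [stepProb, transition]
    exact Finset.sum_nonneg fun p' _ => mul_nonneg (jumpProb_nonneg hd hσ _) (ih p')

/-- One jump already spreads the mass, and further averaging preserves an upper bound. Time zero has
to be excluded, since there the probability can be 1. -/
theorem stepProb_succ_le (hd : Odd d) {σsq M : ℝ} (hσ : 0 < σsq) (a : Idx d)
    (hM : ∀ q : ℤ, jumpProb d σsq q ≤ M) (k : ℕ) (p : Idx d) :
    stepProb d σsq a (k + 1) p ≤ M := by
  induction k generalizing p with
  | zero =>
    simp only [stepProb, transition, mul_ite, mul_one, mul_zero, Finset.sum_ite_eq',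
      Finset.mem_univ, if_true]
    exact hM _
  | succ k ih =>
    rw [stepProb]
    exact (transition_mono hd hσ ih p).trans (transition_const hd hσ M p).le

/-- The expected number of visits of `a` during the times `1, …, n`. -/
noncomputable def laterVisits (d : ℕ) (σsq : ℝ) (a : Idx d) (n : ℕ) (p : Idx d) : ℝ :=
  ∑ k ∈ Finset.range n, stepProb d σsq a (k + 1) p

/-- The Markov property: visits from time 1 on are visits from time 0 on, counted from the position
after the first jump. This is the recursion matched by `walkValue_succ`. -/
theorem transition_visits {σsq : ℝ} (a : Idx d) (n : ℕ) (p : Idx d) :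
    transition d σsq (fun q => (if q = a then 1 else 0) + laterVisits d σsq a n q) p
      = laterVisits d σsq a (n + 1) p := by
  have h : ∀ q, (if q = a then (1 : ℝ) else 0) + laterVisits d σsq a n q
      = ∑ k ∈ Finset.range (n + 1), stepProb d σsq a k q := fun q => by
    rw [laterVisits, Finset.sum_range_succ', add_comm]
    rfl
  simp only [h]
  simp only [transition, laterVisits, Finset.mul_sum]
  rw [Finset.sum_comm]
  rfl

theorem laterVisits_nonneg (hd : Odd d) {σsq : ℝ} (hσ : 0 < σsq) (a : Idx d) (n : ℕ) (p : Idx d) :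
    0 ≤ laterVisits d σsq a n p :=
  Finset.sum_nonneg fun _ _ => stepProb_nonneg hd hσ a _ p

theorem laterVisits_mono (hd : Odd d) {σsq : ℝ} (hσ : 0 < σsq) (a : Idx d) {n m : ℕ} (h : n ≤ m)
    (p : Idx d) : laterVisits d σsq a n p ≤ laterVisits d σsq a m p :=
  Finset.sum_le_sum_of_subset_of_nonneg (Finset.range_mono h)
    fun _ _ _ => stepProb_nonneg hd hσ a _ p

end QuasiIdealClock
-- Bonferroni bounds for the hit product, and the spectral gap.
namespace QuasiIdealClock

variable {d : ℕ}

/-- The largest label. -/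
def lastLabel (hd : Odd d) : Idx d :=
  ⟨((d : ℤ) - 1) / 2, by
    rw [mem_idx_iff hd]
    obtain ⟨e, rfl⟩ := hd
    push_cast
    omega⟩

/-- The factor that the walk collects at a label. -/
noncomputable def hitFactor (hd : Odd d) (c : ℝ) (p : Idx d) : ℝ :=
  1 - c * (if p = lastLabel hd then 1 else 0)

theorem hitFactor_eq (hd : Odd d) (c : ℝ) (p : Idx d) :
    hitFactor hd c p = 1 - c * (if (p : ℤ) = ((d : ℤ) - 1) / 2 then 1 else 0) := by
  simp only [hitFactor, Subtype.ext_iff, lastLabel]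

theorem abs_hitFactor_le (hd : Odd d) {c : ℝ} (hc0 : 0 ≤ c) (hc2 : c ≤ 2) (p : Idx d) :
    |hitFactor hd c p| ≤ 1 := by
  rw [hitFactor, abs_le]
  split_ifs <;> constructor <;> linarith

theorem abs_hitFactor_two (hd : Odd d) (p : Idx d) : |hitFactor hd 2 p| = 1 := by
  rw [hitFactor]
  split_ifs <;> norm_num

/-- The expectation of the product of the hit factors over `n` jumps. -/
noncomputable def walkValue (d : ℕ) (σsq c : ℝ) (n : ℕ) (p : Idx d) : ℝ :=
  walkExpectation d σsq n p (antipodeProduct d c n)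

theorem walkValue_zero (hd : Odd d) (σsq c : ℝ) (p : Idx d) :
    walkValue d σsq c 0 p = hitFactor hd c p := by
  rw [walkValue, walkExpectation, ← (Equiv.funUnique (Fin 1) (Idx d)).symm.sum_comp]
  simp [antipodeProduct, hitFactor_eq]

/-- Decomposition by the first jump: the starting label contributes its own factor, and the
remaining path is a walk started afresh. -/
theorem walkValue_succ (hd : Odd d) (σsq c : ℝ) (n : ℕ) (p : Idx d) :
    walkValue d σsq c (n + 1) p
      = hitFactor hd c p * transition d σsq (walkValue d σsq c n) p := by
  rw [walkValue, walkExpectation, ← (Fin.consEquiv (fun _ => Idx d)).sum_comp,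
    Fintype.sum_prod_type]
  have h1 : ∀ (x : Idx d) (q : Fin (n + 1) → Idx d),
      antipodeProduct d c (n + 1) (Fin.cons x q) = hitFactor hd c x * antipodeProduct d c n q :=
    fun x q => by
      simp [antipodeProduct, Fin.prod_univ_succ, hitFactor_eq]
  have h2 : ∀ (x : Idx d) (q : Fin (n + 1) → Idx d),
      (∏ j : Fin (n + 1), jumpProb d σsq
        (((Fin.cons x q : Fin (n + 2) → Idx d) j.succ : ℤ)
          - ((Fin.cons x q : Fin (n + 2) → Idx d) j.castSucc : ℤ)))
      = jumpProb d σsq ((q 0 : ℤ) - (x : ℤ))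
        * ∏ j : Fin n, jumpProb d σsq ((q j.succ : ℤ) - (q j.castSucc : ℤ)) := fun x q => by
    rw [Fin.prod_univ_succ]
    simp
  simp only [Fin.consEquiv, Equiv.coe_fn_mk, h1, h2, Fin.cons_zero]
  rw [Finset.sum_comm]
  simp only [Finset.sum_ite_eq', Finset.mem_univ, if_true]
  simp only [transition, walkValue, walkExpectation, Finset.mul_sum]
  rw [Finset.sum_comm]
  refine Finset.sum_congr rfl fun q _ => ?_
  simp only [mul_ite, mul_zero, Finset.sum_ite_eq, Finset.mem_univ, if_true]
  ring

theorem abs_transition_le (hd : Odd d) {σsq : ℝ} (hσ : 0 < σsq) {f : Idx d → ℝ} {M : ℝ}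
    (h : ∀ p, |f p| ≤ M) (p : Idx d) : |transition d σsq f p| ≤ M := by
  rw [abs_le]
  constructor
  · exact (transition_const hd hσ (-M) p).ge.trans
      (transition_mono hd hσ (fun q => (abs_le.mp (h q)).1) p)
  · exact (transition_mono hd hσ (fun q => (abs_le.mp (h q)).2) p).trans
      (transition_const hd hσ M p).le

theorem abs_walkValue_le (hd : Odd d) {σsq c : ℝ} (hσ : 0 < σsq) (hc0 : 0 ≤ c) (hc2 : c ≤ 2)
    (n : ℕ) (p : Idx d) : |walkValue d σsq c n p| ≤ 1 := by
  induction n generalizing p with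
  | zero => rw [walkValue_zero hd]; exact abs_hitFactor_le hd hc0 hc2 p
  | succ n ih =>
    rw [walkValue_succ hd, abs_mul]
    exact mul_le_one₀ (abs_hitFactor_le hd hc0 hc2 p) (abs_nonneg _) (abs_transition_le hd hσ ih p)

/-- Bonferroni bounds for the expectation of the product of the hit factors. -/
theorem walkValue_bounds (hd : Odd d) {σsq c ρ : ℝ} (hσ : 0 < σsq) (hc0 : 0 ≤ c) (hc2 : c ≤ 2)
    (hρ : 0 ≤ ρ) (n : ℕ) (h : ∀ p, laterVisits d σsq (lastLabel hd) n p ≤ ρ) (p : Idx d) :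
    1 + -c * ((if p = lastLabel hd then 1 else 0) + laterVisits d σsq (lastLabel hd) n p)
        ≤ walkValue d σsq c n p ∧
      walkValue d σsq c n p ≤ 1 + -(c * (1 - c * ρ)) *
        ((if p = lastLabel hd then 1 else 0) + laterVisits d σsq (lastLabel hd) n p) := by
  induction n generalizing p with
  | zero =>
    rw [walkValue_zero hd, hitFactor]
    simp only [laterVisits, Finset.range_zero, Finset.sum_empty, add_zero]
    split_ifs
    · constructor <;> nlinarith [mul_nonneg (mul_nonneg hc0 hc0) hρ]
    · simp
  | succ n ih =>
    have ih' := ih (fun q => (laterVisits_mono hd hσ _ n.le_succ q).trans (h q))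
    have h1 := transition_mono hd hσ (fun q => (ih' q).1) p
    have h2 := transition_mono hd hσ (fun q => (ih' q).2) p
    rw [transition_affine hd hσ, transition_visits] at h1 h2
    have h3 := abs_le.mp (abs_transition_le hd hσ (abs_walkValue_le hd hσ hc0 hc2 n) p)
    have h4 := laterVisits_nonneg hd hσ (lastLabel hd) (n + 1) p
    have h5 := h p
    rw [walkValue_succ hd, hitFactor]
    generalize transition d σsq (walkValue d σsq c n) p = W at *
    generalize laterVisits d σsq (lastLabel hd) (n + 1) p = L at *
    have h6 : 0 ≤ c * c := mul_nonneg hc0 hc0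
    have h7 : 0 ≤ c * c * ρ := mul_nonneg h6 hρ
    have h8 : c * c * L ≤ c * c * ρ := mul_le_mul_of_nonneg_left h5 h6
    have h9 : 0 ≤ c * c * L := mul_nonneg h6 h4
    have h10 : 0 ≤ c * (c * c * ρ) * L := by positivity
    have h11 : 0 ≤ c * c * ρ * L := by positivity
    split_ifs
    -- At a hit the factor `1 - c` multiplies the later value `W`. For `c ≥ 1` it reverses
    -- inequalities, so the upper bound comes from the lower bound on `W` and the lower bound from
    -- `W ≤ 1`. The error `c² L ≤ c² ρ` from visits after a hit is the source of the correction `c *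
    -- ρ`.
    · rcases le_total c 1 with h0 | h0
      · have h12 := mul_le_mul_of_nonneg_left h1 (sub_nonneg.mpr h0)
        have h13 := mul_le_mul_of_nonneg_left h2 (sub_nonneg.mpr h0)
        constructor <;> nlinarith
      · have h12 := mul_le_mul_of_nonneg_left h1 (sub_nonneg.mpr h0)
        have h13 := mul_le_mul_of_nonneg_left h3.2 (sub_nonneg.mpr h0)
        have h14 : 0 ≤ c * L := mul_nonneg hc0 h4
        constructor <;> nlinarith
    · constructor <;> linarith

/-- Averaging the Bonferroni bounds over one jump removes the indicator of the starting label. This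
gives a two-sided bound even for a walk that starts at the last label, where the product itself is
close to `1 - c`. -/
theorem transition_walkValue_bounds (hd : Odd d) {σsq c ρ : ℝ} (hσ : 0 < σsq) (hc0 : 0 ≤ c)
    (hc2 : c ≤ 2) (hρ : 0 ≤ ρ) (n : ℕ)
    (h : ∀ p, laterVisits d σsq (lastLabel hd) (n + 1) p ≤ ρ) (p : Idx d) :
    1 - c * ρ ≤ transition d σsq (walkValue d σsq c n) p ∧
      transition d σsq (walkValue d σsq c n) p ≤ 1 - c * (1 - c * ρ) *
        laterVisits d σsq (lastLabel hd) (n + 1) p := by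
  have ih' := walkValue_bounds hd hσ hc0 hc2 hρ n
    (fun q => (laterVisits_mono hd hσ _ n.le_succ q).trans (h q))
  have h1 := transition_mono hd hσ (fun q => (ih' q).1) p
  have h2 := transition_mono hd hσ (fun q => (ih' q).2) p
  rw [transition_affine hd hσ, transition_visits] at h1 h2
  have h3 := mul_le_mul_of_nonneg_left (h p) hc0
  constructor <;> linarith

theorem abs_coe_le (hd : Odd d) (m : Idx d) : |((m : ℤ) : ℝ)| ≤ d / 2 := by
  have h := (mem_idx_iff hd m).mp m.2
  obtain ⟨e, rfl⟩ := hd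
  push_cast at h
  have h1 : -(e : ℤ) ≤ m := by omega
  have h2 : (m : ℤ) ≤ e := by omega
  have h1' : -(e : ℝ) ≤ ((m : ℤ) : ℝ) := by exact_mod_cast h1
  have h2' : ((m : ℤ) : ℝ) ≤ e := by exact_mod_cast h2
  rw [abs_le]
  push_cast
  constructor <;> linarith

/-- The spectral gap of the transition operator. -/
theorem eigenvalue_le (hd : Odd d) (hd3 : 3 ≤ d) {σsq : ℝ} (hσ : 0 < σsq) (m : Idx d)
    (hm : (m : ℤ) ≠ 0) {x : ℝ} (hx : x = Real.pi / (2 * σsq * d))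
    (h1 : 4 * Real.pi ≤ (d : ℝ) ^ 2 * x)
    (h2 : 16 * (theta3 0 1 * Real.exp Real.pi) ≤ (d : ℝ) ^ 2 * x ^ 2) :
    eigenvalue d σsq m ≤ Real.exp (-(x / 2)) := by
  have h0 : (0 : ℝ) < d := by exact_mod_cast hd.pos
  have hd3' : (3 : ℝ) ≤ d := by exact_mod_cast hd3
  have hpi := Real.pi_pos
  have hx0 : 0 < x := by rw [hx]; positivity
  set s : ℝ := 2 * σsq / d with hs
  have hs0 : 0 < s := by positivity
  have hsx : 1 / s = (d : ℝ) ^ 2 * x / Real.pi := by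
    rw [hx, hs]; field_simp
  have hs4 : 4 ≤ 1 / s := by
    rw [hsx, le_div_iff₀ hpi]; exact h1
  set z : ℝ := ((m : ℤ) : ℝ) / d with hz
  have hz2 : |z| ≤ 1 / 2 := by
    rw [hz, abs_div, abs_of_pos h0, div_le_iff₀ h0]
    linarith [abs_coe_le hd m]
  have hK := one_le_theta3_zero one_pos
  -- In the Poisson series the term `j = 0` is at most `exp (-x)`. For `j ≠ 0`, `|z| ≤ 1/2` gives
  -- `(z + j)² ≥ j² / 4`, and `1 / s ≥ 4` then splits off a uniformly small factor while leaving a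
  -- summable Gaussian in `j`.
  have hterm : ∀ j : ℤ, Real.exp (-(Real.pi * (z + j) ^ 2 / s)) ≤
      (if j = 0 then Real.exp (-x) else 0)
        + Real.exp (Real.pi - (d : ℝ) ^ 2 * x / 4) * gaussWeight 1 j := fun j => by
    split_ifs with hj
    · have hm1 : (1 : ℝ) ≤ ((m : ℤ) : ℝ) ^ 2 := by
        have : (1 : ℤ) ≤ (m : ℤ) ^ 2 := by
          have := sq_pos_of_ne_zero hm
          omega
        exact_mod_cast this
      have : x ≤ Real.pi * (z + j) ^ 2 / s := by
        rw [hj, hx, hz, hs, Int.cast_zero, add_zero, div_pow]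
        rw [show Real.pi * (((m : ℤ) : ℝ) ^ 2 / (d : ℝ) ^ 2) / (2 * σsq / d)
          = Real.pi / (2 * σsq * d) * ((m : ℤ) : ℝ) ^ 2 by field_simp]
        exact le_mul_of_one_le_right (by positivity) hm1
      have h3 := Real.exp_le_exp.mpr (neg_le_neg this)
      have h4 := mul_pos (Real.exp_pos (Real.pi - (d : ℝ) ^ 2 * x / 4)) (gaussWeight_pos 1 j)
      linarith
    · rw [zero_add, gaussWeight, ← Real.exp_add, Real.exp_le_exp]
      have hj1 : (1 : ℝ) ≤ |(j : ℝ)| := by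
        exact_mod_cast Int.one_le_abs hj
      have h3 : |(j : ℝ)| / 2 ≤ |z + j| := by
        have := abs_sub_abs_le_abs_sub (j : ℝ) (-z)
        rw [abs_neg, sub_neg_eq_add, add_comm (j : ℝ) z] at this
        linarith
      have h4 : (j : ℝ) ^ 2 / 4 ≤ (z + j) ^ 2 := by
        rw [← sq_abs (z + j), ← sq_abs (j : ℝ)]
        nlinarith [abs_nonneg (z + j), abs_nonneg (j : ℝ)]
      have h5 : (1 : ℝ) ≤ (j : ℝ) ^ 2 := by
        rw [← sq_abs]; nlinarith
      have h6 : (d : ℝ) ^ 2 * x = Real.pi * (1 / s) := by rw [hsx]; field_simp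
      rw [h6, mul_div_assoc, div_eq_mul_one_div _ s]
      have h7 : (1 / s - 4) / 4 + (j : ℝ) ^ 2 ≤ (z + j) ^ 2 * (1 / s) := by
        have h8 := mul_le_mul_of_nonneg_right h4 (by linarith : 0 ≤ 1 / s)
        have h9 := mul_le_mul_of_nonneg_right h5 (by linarith : 0 ≤ 1 / s - 4)
        linarith
      have h8 := mul_le_mul_of_nonneg_left h7 hpi.le
      linarith
  have hsum := hasSum_le hterm (hasSum_theta3_poisson hs0 z)
    ((hasSum_ite_eq (0 : ℤ) (Real.exp (-x))).add ((hasSum_theta3_zero one_pos).mul_left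
      (Real.exp (Real.pi - (d : ℝ) ^ 2 * x / 4))))
  -- The denominator of the eigenvalue satisfies `√s θ₃(0, is) = θ₃(0, i/s) ≥ 1`.
  have hev : eigenvalue d σsq m ≤ Real.sqrt s * theta3 z s := by
    have h3 := sqrt_mul_theta3_zero hs0
    have h4 := one_le_theta3_zero (one_div_pos.mpr hs0)
    have h5 := theta3_pos hs0 0
    have h6 := theta3_pos hs0 z
    rw [eigenvalue, ← hs, ← hz, div_le_iff₀ h5, mul_right_comm, h3]
    exact le_mul_of_one_le_left h6.le h4
  refine (hev.trans hsum).trans ?_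
  -- The tail costs at most a relative error `x / 2`, so that the sum is at most `exp (-x) * (1 + x
  -- / 2) ≤ exp (-x / 2)`. Since `d² ≥ 9`, half of the exponent `d² x / 4` pays for `exp (-x)`, and
  -- `exp (-y) ≤ 1 / y` is applied to the other half.
  have h3 : Real.exp (Real.pi - (d : ℝ) ^ 2 * x / 4) * theta3 0 1
      ≤ Real.exp (-x) * (x / 2) := by
    have h4 : Real.exp (Real.pi - (d : ℝ) ^ 2 * x / 4)
        ≤ Real.exp Real.pi * Real.exp (-x) * Real.exp (-((d : ℝ) ^ 2 * x / 8)) := by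
      rw [← Real.exp_add, ← Real.exp_add, Real.exp_le_exp]
      have h5 : (9 : ℝ) ≤ (d : ℝ) ^ 2 := by nlinarith
      linarith [mul_le_mul_of_nonneg_right h5 hx0.le]
    have h5 : Real.exp (-((d : ℝ) ^ 2 * x / 8)) ≤ 8 / ((d : ℝ) ^ 2 * x) := by
      have hy : 0 < (d : ℝ) ^ 2 * x / 8 := by positivity
      rw [Real.exp_neg, ← inv_div ((d : ℝ) ^ 2 * x) 8]
      exact inv_anti₀ hy ((le_add_of_nonneg_right zero_le_one).trans (Real.add_one_le_exp _))
    have h6 : theta3 0 1 * Real.exp Real.pi * (8 / ((d : ℝ) ^ 2 * x)) ≤ x / 2 := by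
      rw [mul_div_assoc', div_le_iff₀ (by positivity)]
      nlinarith
    calc _ ≤ Real.exp Real.pi * Real.exp (-x) * Real.exp (-((d : ℝ) ^ 2 * x / 8)) * theta3 0 1 :=
          mul_le_mul_of_nonneg_right h4 (by linarith)
      _ ≤ Real.exp Real.pi * Real.exp (-x) * (8 / ((d : ℝ) ^ 2 * x)) * theta3 0 1 := by
          gcongr
      _ = Real.exp (-x) * (theta3 0 1 * Real.exp Real.pi * (8 / ((d : ℝ) ^ 2 * x))) := by ring
      _ ≤ _ := by gcongr
  have h4 : Real.exp (-(x / 2)) = Real.exp (-x) * Real.exp (x / 2) := by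
    rw [← Real.exp_add]; congr 1; ring
  rw [h4]
  nlinarith [Real.add_one_le_exp (x / 2), Real.exp_pos (-x)]

/-- The random walk visits `a` about as often as a uniformly distributed sequence does. -/
theorem le_laterVisits (hd : Odd d) (hd3 : 3 ≤ d) {σsq : ℝ} (hσ : 0 < σsq) {x : ℝ}
    (hx : x = Real.pi / (2 * σsq * d)) (h1 : 4 * Real.pi ≤ (d : ℝ) ^ 2 * x)
    (h2 : 16 * (theta3 0 1 * Real.exp Real.pi) ≤ (d : ℝ) ^ 2 * x ^ 2) (a : Idx d)
    {s n : ℕ} (hsn : s ≤ n) (p : Idx d) :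
    ((n : ℝ) - s) * ((1 - d * Real.exp (-(x / 2 * s))) / d) ≤ laterVisits d σsq a n p := by
  have h0 : (0 : ℝ) < d := by exact_mod_cast hd.pos
  have hx0 : 0 < x := by rw [hx]; positivity
  have h3 : ∀ k ∈ Finset.Ico s n,
      (1 - d * Real.exp (-(x / 2 * s))) / d ≤ stepProb d σsq a (k + 1) p := fun k hk => by
    refine le_trans ?_ (le_stepProb hd hσ a (k + 1) p
      (fun m hm => eigenvalue_le hd hd3 hσ m hm hx h1 h2) (Real.exp_pos _).le)
    have hk' : (s : ℝ) ≤ k := by exact_mod_cast (Finset.mem_Ico.mp hk).1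
    rw [← Real.exp_nat_mul]
    gcongr
    push_cast
    nlinarith
  have h4 := Finset.sum_le_sum h3
  rw [Finset.sum_const, Nat.card_Ico, nsmul_eq_mul, Nat.cast_sub hsn] at h4
  refine h4.trans (Finset.sum_le_sum_of_subset_of_nonneg ?_
    fun _ _ _ => stepProb_nonneg hd hσ a _ p)
  intro k hk
  rw [Finset.mem_range]
  exact (Finset.mem_Ico.mp hk).2

theorem laterVisits_le (hd : Odd d) {σsq : ℝ} (hσ : 0 < σsq) (a : Idx d) (n : ℕ) (p : Idx d) :
    laterVisits d σsq a n p ≤ n * (theta3 0 1 * (1 + Real.sqrt (2 * σsq * d)) / d) := by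
  have := Finset.sum_le_sum fun k (_ : k ∈ Finset.range n) =>
    stepProb_succ_le hd hσ a (jumpProb_le hd hσ) k p
  rwa [Finset.sum_const, Finset.card_range, nsmul_eq_mul] at this

end QuasiIdealClock
-- Asymptotics of visits and of the hit product as `d → ∞`.
namespace QuasiIdealClock

theorem tendsto_natCast_rpow_atTop {γ : ℝ} (hγ : 0 < γ) :
    Tendsto (fun d : ℕ => (d : ℝ) ^ γ) atTop atTop :=
  (tendsto_rpow_atTop hγ).comp tendsto_natCast_atTop_atTop

theorem tendsto_natCast_rpow_neg {γ : ℝ} (hγ : γ < 0) :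
    Tendsto (fun d : ℕ => (d : ℝ) ^ γ) atTop (𝓝 0) := by
  have := (tendsto_rpow_neg_atTop (neg_pos.mpr hγ)).comp
    (tendsto_natCast_atTop_atTop (R := ℝ))
  simpa [Function.comp_def] using this

theorem tendsto_mul_exp_neg_rpow {κ γ : ℝ} (hκ : 0 < κ) (hγ : 0 < γ) :
    Tendsto (fun d : ℕ => (d : ℝ) * Real.exp (-(κ * (d : ℝ) ^ γ))) atTop (𝓝 0) := by
  refine ((tendsto_rpow_mul_exp_neg_mul_atTop_nhds_zero (1 / γ) κ hκ).comp
    (tendsto_natCast_rpow_atTop hγ)).congr fun d => ?_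
  simp only [Function.comp]
  rw [← Real.rpow_mul (Nat.cast_nonneg d), mul_one_div_cancel hγ.ne', Real.rpow_one, neg_mul]

/-- The margin `ε` is split in three: waiting for equidistribution, rounding of the step numbers,
and the remaining deviation from `1 / d`. The waiting time is long enough because the gap times `√d`
is of order `d ^ (-1/2 - β)`, whose exponent is positive, so its exponential beats the factor `d`.
-/
theorem eventually_le_laterVisits {c₂ t β ε : ℝ} (hc₂ : 0 < c₂) (ht : 0 < t)
    (hβ : β < -(1 / 2)) (hε0 : 0 < ε) (hε1 : ε < 1) :
    ∀ᶠ d : ℕ in atTop, ∀ _ : Odd d, ∀ n : ℕ, n + 1 = ⌈t * Real.sqrt d⌉₊ → ∀ a p : Idx d,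
      (1 - ε) * (t / Real.sqrt d) ≤ laterVisits d (c₂ * (d : ℝ) ^ β) a n p := by
  have hpi := Real.pi_pos
  set C : ℝ := 16 * (theta3 0 1 * Real.exp Real.pi)
  have e1 : ∀ᶠ d : ℕ in atTop, max (max 1 C) (4 * Real.pi)
      ≤ Real.pi / (2 * c₂) * (d : ℝ) ^ (-β) :=
    ((tendsto_natCast_rpow_atTop (by linarith)).const_mul_atTop (by positivity)).eventually_ge_atTop
      _
  have e2 : ∀ᶠ d : ℕ in atTop, (d : ℝ) * Real.exp (-(Real.pi / (4 * c₂) * (ε / 3 * t)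
      * (d : ℝ) ^ (-(1 / 2) - β))) < ε / 3 :=
    (tendsto_mul_exp_neg_rpow (by positivity) (by linarith)).eventually_lt_const (by positivity)
  have e3 : ∀ᶠ d : ℕ in atTop, 2 / (ε / 3 * t) ≤ (d : ℝ) ^ (1 / 2 : ℝ) :=
    (tendsto_natCast_rpow_atTop (by norm_num)).eventually_ge_atTop _
  filter_upwards [e1, e2, e3, eventually_ge_atTop 3] with d h1 h2 h3 hd3 hd n hn a p
  have h0 : (0 : ℝ) < d := by exact_mod_cast hd.pos
  have hd3' : (3 : ℝ) ≤ d := by exact_mod_cast hd3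
  rw [← Real.sqrt_eq_rpow, div_le_iff₀ (by positivity)] at h3
  set σsq := c₂ * (d : ℝ) ^ β with hσ
  have hσ0 : 0 < σsq := by positivity
  set x : ℝ := Real.pi / (2 * σsq * d) with hx
  have hdx : d * x = Real.pi / (2 * c₂) * (d : ℝ) ^ (-β) := by
    rw [hx, hσ, Real.rpow_neg h0.le]; field_simp
  rw [← hdx] at h1
  have h1a : 1 ≤ d * x := (le_max_left _ _).trans ((le_max_left _ _).trans h1)
  have h1b : C ≤ d * x := (le_max_right _ _).trans ((le_max_left _ _).trans h1)
  have h1c : 4 * Real.pi ≤ d * x := (le_max_right _ _).trans h1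
  have hsq := Real.sqrt_pos.mpr h0
  have hss := Real.mul_self_sqrt h0.le
  have hxs : x * Real.sqrt d = Real.pi / (2 * c₂) * (d : ℝ) ^ (-(1 / 2) - β) := by
    rw [hx, hσ, Real.rpow_sub h0, Real.rpow_neg h0.le, ← Real.sqrt_eq_rpow]
    field_simp
    rw [sq, hss]
  set s : ℕ := ⌈ε / 3 * t * Real.sqrt d⌉₊ with hs
  have hs1 : ε / 3 * t * Real.sqrt d ≤ s := Nat.le_ceil _
  have hs2 : (s : ℝ) < ε / 3 * t * Real.sqrt d + 1 := Nat.ceil_lt_add_one (by positivity)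
  have hn1 : t * Real.sqrt d ≤ n + 1 := by
    have := Nat.le_ceil (t * Real.sqrt d)
    rw [← hn] at this
    exact_mod_cast this
  have hts : 0 < t * Real.sqrt d := by positivity
  -- Two units are lost: one because `n` counts jumps rather than positions, one from rounding `s`
  -- up. The condition `h3` makes both together at most `ε / 3 * t * √d`.
  have hns : (1 - 2 * (ε / 3)) * (t * Real.sqrt d) ≤ (n : ℝ) - s := by nlinarith
  have hns0 : 0 ≤ (n : ℝ) - s := le_trans (mul_nonneg (by linarith) hts.le) hns
  have hsn : s ≤ n := by
    have : (s : ℝ) ≤ n := by linarith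
    exact_mod_cast this
  refine le_trans ?_ (le_laterVisits hd hd3 hσ0 hx (by nlinarith) (by nlinarith) a hsn p)
  have hη : d * Real.exp (-(x / 2 * s)) ≤ ε / 3 := by
    refine le_trans ?_ h2.le
    refine mul_le_mul_of_nonneg_left (Real.exp_le_exp.mpr (neg_le_neg ?_)) h0.le
    have hx0 : 0 < x := by rw [hx]; positivity
    have := mul_le_mul_of_nonneg_left hs1 (half_pos hx0).le
    calc _ = (x * Real.sqrt d) * (1 / 2) * (ε / 3 * t) := by rw [hxs]; ring
      _ ≤ _ := by linarith
  calc (1 - ε) * (t / Real.sqrt d) = (1 - ε) * (t * Real.sqrt d) / d := by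
        field_simp
        rw [sq, hss]
    _ ≤ (1 - 2 * (ε / 3)) * (t * Real.sqrt d) * (1 - ε / 3) / d := by
        rw [mul_right_comm]
        refine div_le_div_of_nonneg_right (mul_le_mul_of_nonneg_right ?_ hts.le) h0.le
        nlinarith
    _ ≤ ((n : ℝ) - s) * (1 - d * Real.exp (-(x / 2 * s))) / d := by
        gcongr
        linarith
    _ = _ := by ring

/-- At most `t√d` steps, each hitting with probability of order `1 / d + √(σ² / d)`, give `O(d ^
(-1/2) + d ^ (β / 2))` visits, uniformly in the start. -/
theorem eventually_laterVisits_le {c₂ t β ρ : ℝ} (hc₂ : 0 < c₂) (ht : 0 < t)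
    (hβ : β < -(1 / 2)) (hρ : 0 < ρ) :
    ∀ᶠ d : ℕ in atTop, ∀ _ : Odd d, ∀ n : ℕ, n + 1 = ⌈t * Real.sqrt d⌉₊ → ∀ a p : Idx d,
      laterVisits d (c₂ * (d : ℝ) ^ β) a n p ≤ ρ := by
  have h1 : Tendsto (fun d : ℕ => t * theta3 0 1 * ((d : ℝ) ^ (-(1 / 2) : ℝ)
      + Real.sqrt (2 * c₂) * (d : ℝ) ^ (β / 2))) atTop (𝓝 0) := by
    have := ((tendsto_natCast_rpow_neg (γ := -(1 / 2)) (by norm_num)).add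
      ((tendsto_natCast_rpow_neg (γ := β / 2) (by linarith)).const_mul
        (Real.sqrt (2 * c₂)))).const_mul (t * theta3 0 1)
    simpa using this
  filter_upwards [h1.eventually_lt_const hρ] with d h2 hd n hn a p
  have h0 : (0 : ℝ) < d := by exact_mod_cast hd.pos
  have hσ0 : 0 < c₂ * (d : ℝ) ^ β := by positivity
  refine (laterVisits_le hd hσ0 a n p).trans (le_trans ?_ h2.le)
  have hK := one_le_theta3_zero one_pos
  have hn1 : (n : ℝ) ≤ t * Real.sqrt d := by
    have h3 : ((n + 1 : ℕ) : ℝ) < t * Real.sqrt d + 1 := by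
      rw [hn]; exact Nat.ceil_lt_add_one (by positivity)
    push_cast at h3
    linarith
  have hsq := Real.sqrt_pos.mpr h0
  have hss := Real.mul_self_sqrt h0.le
  have h4 : Real.sqrt (2 * (c₂ * (d : ℝ) ^ β) * d)
      = Real.sqrt (2 * c₂) * ((d : ℝ) ^ (β / 2) * Real.sqrt d) := by
    rw [← mul_assoc 2 c₂, mul_assoc (2 * c₂), Real.sqrt_mul (x := 2 * c₂) (by positivity),
      Real.sqrt_mul (x := (d : ℝ) ^ β) (by positivity), Real.sqrt_eq_rpow ((d : ℝ) ^ β),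
      ← Real.rpow_mul h0.le, mul_one_div]
  have h5 : (d : ℝ) ^ (-(1 / 2) : ℝ) = 1 / Real.sqrt d := by
    rw [Real.rpow_neg h0.le, ← Real.sqrt_eq_rpow, one_div]
  calc _ ≤ t * Real.sqrt d * (theta3 0 1 * (1 + Real.sqrt (2 * (c₂ * (d : ℝ) ^ β) * d)) / d) := by
        gcongr
    _ = _ := by
        rw [h4, h5]
        field_simp
        rw [sq, hss]

/-- Upper bound for the expectation of the product of the hit factors along the walk. -/
theorem eventually_walkValue_le {c₂ c t β ε : ℝ} (hc₂ : 0 < c₂) (hc0 : 0 ≤ c) (hc2 : c ≤ 2)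
    (ht : 0 < t) (hβ : β < -(1 / 2)) (hε : 0 < ε) :
    ∀ᶠ d : ℕ in atTop, ∀ _ : Odd d, ∀ n : ℕ, n + 1 = ⌈t * Real.sqrt d⌉₊ → ∀ p : Idx d,
      walkValue d (c₂ * (d : ℝ) ^ β) c n p ≤ 1 - (1 - ε) * c * (t / Real.sqrt d) := by
  rcases lt_or_ge ε 1 with hε1 | hε1
  · filter_upwards [eventually_le_laterVisits hc₂ ht hβ (half_pos hε) (by linarith),
      eventually_laterVisits_le hc₂ ht hβ (by positivity : 0 < ε / 4)] with d h1 h2 hd n hn p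
    have h0 : (0 : ℝ) < d := by exact_mod_cast hd.pos
    have hσ0 : 0 < c₂ * (d : ℝ) ^ β := by positivity
    refine (walkValue_bounds hd hσ0 hc0 hc2 (by positivity) n
      (h2 hd n hn (lastLabel hd)) p).2.trans ?_
    have h3 := h1 hd n hn (lastLabel hd) p
    have hu : 0 < t / Real.sqrt d := by positivity
    generalize t / Real.sqrt d = u at *
    have h4 : u * (1 - ε / 2) ≤ (if p = lastLabel hd then 1 else 0)
        + laterVisits d (c₂ * (d : ℝ) ^ β) (lastLabel hd) n p := by
      split_ifs <;> linarith
    have h5 : c * (1 - ε / 2) ≤ c * (1 - c * (ε / 4)) :=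
      mul_le_mul_of_nonneg_left (by nlinarith) hc0
    have h6 : c * (1 - ε / 2) * (u * (1 - ε / 2)) ≤ c * (1 - c * (ε / 4))
        * ((if p = lastLabel hd then 1 else 0)
          + laterVisits d (c₂ * (d : ℝ) ^ β) (lastLabel hd) n p) :=
      mul_le_mul h5 h4 (mul_nonneg hu.le (by linarith))
        ((mul_nonneg hc0 (by linarith)).trans h5)
    have h7 : 0 ≤ c * u * (ε / 2) ^ 2 := by positivity
    nlinarith
  · refine Eventually.of_forall fun d hd n _ p => ?_
    have h0 : (0 : ℝ) < d := by exact_mod_cast hd.pos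
    have h1 := (abs_le.mp (abs_walkValue_le hd (by positivity : 0 < c₂ * (d : ℝ) ^ β)
      hc0 hc2 n p)).2
    have h2 : 0 ≤ (ε - 1) * c * (t / Real.sqrt d) :=
      mul_nonneg (mul_nonneg (by linarith) hc0) (by positivity)
    linarith

/-- The factor at the starting label is a sign, so it disappears in the absolute value; what remains
is positive because revisits are rare. With the chosen margins the decrement is `2 * (1 - 2/8) *
(3/4) = 9/8` times `t / √d`. -/
theorem eventually_abs_walkValue_two_le {c₂ t β : ℝ} (hc₂ : 0 < c₂) (ht : 0 < t)
    (hβ : β < -(1 / 2)) :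
    ∀ᶠ d : ℕ in atTop, ∀ _ : Odd d, ∀ n : ℕ, n + 1 = ⌈t * Real.sqrt d⌉₊ → ∀ p : Idx d,
      |walkValue d (c₂ * (d : ℝ) ^ β) 2 n p| ≤ 1 - t / Real.sqrt d := by
  filter_upwards [eventually_le_laterVisits hc₂ ht hβ (by norm_num : (0 : ℝ) < 1 / 4)
    (by norm_num), eventually_laterVisits_le hc₂ ht hβ (by norm_num : (0 : ℝ) < 1 / 8)]
    with d h1 h2 hd n hn p
  have h0 : (0 : ℝ) < d := by exact_mod_cast hd.pos
  have hσ0 : 0 < c₂ * (d : ℝ) ^ β := by positivity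
  have hu : 0 < t / Real.sqrt d := by positivity
  have h3 := h1 hd n hn (lastLabel hd) p
  cases n with
  -- Without jumps there are no later visits, contradicting their positive lower bound.
  | zero =>
    simp only [laterVisits, Finset.range_zero, Finset.sum_empty] at h3
    linarith
  | succ n =>
    rw [walkValue_succ hd, abs_mul, abs_hitFactor_two, one_mul]
    have h4 := transition_walkValue_bounds hd hσ0 zero_le_two le_rfl (by norm_num) n
      (h2 hd (n + 1) hn (lastLabel hd)) p
    rw [abs_of_nonneg (by linarith)]
    linarith

end QuasiIdealClock
-- Action of measurement and evolution on shift observables.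
namespace QuasiIdealClock

theorem integral_charExp {L : ℝ} (hL : 0 < L) (k : ℤ) :
    ∫ x in Set.Icc (-(L / 2)) (L / 2), charExp (k * x / L) = if k = 0 then (L : ℂ) else 0 := by
  rw [MeasureTheory.integral_Icc_eq_integral_Ioc,
    ← intervalIntegral.integral_of_le (by linarith)]
  split_ifs with hk
  · simp [hk]
  · have hL' : (L : ℂ) ≠ 0 := by exact_mod_cast hL.ne'
    have hc : (2 * Real.pi * Complex.I * k / L : ℂ) ≠ 0 :=
      div_ne_zero (mul_ne_zero Complex.two_pi_I_ne_zero (by exact_mod_cast hk)) hL'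
    have h : ∀ x : ℝ, charExp (k * x / L) = Complex.exp ((2 * Real.pi * Complex.I * k / L : ℂ) * x) :=
      fun x => by
        rw [charExp]
        congr 1
        push_cast
        ring
    simp only [h]
    rw [integral_exp_mul_complex hc, ← h, ← h]
    have h2 : (k : ℝ) * (L / 2) / L = k * (-(L / 2)) / L + k := by
      field_simp
      ring
    rw [h2, charExp_add_int, sub_self, zero_div]

theorem hasSum_prod_mul {f g : ℤ → ℂ} {F G : ℂ} (hf : Summable fun m => ‖f m‖)
    (hg : Summable fun m => ‖g m‖) (hF : HasSum f F) (hG : HasSum g G) :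
    HasSum (fun q : ℤ × ℤ => f q.1 * g q.2) (F * G) :=
  hF.mul hG (summable_mul_of_summable_norm hf hg)

/-- Parseval's identity for absolutely convergent Fourier series. -/
theorem hasSum_integral_mul {L : ℝ} (hL : 0 < L) (r : ℤ) {f g : ℤ → ℂ} {F G : ℝ → ℂ}
    (hf : Summable fun m => ‖f m‖) (hg : Summable fun m => ‖g m‖)
    (hF : ∀ x, HasSum (fun m => f m * charExp (-(m * x / L))) (F x))
    (hG : ∀ x, HasSum (fun m => g m * charExp (-(m * x / L))) (G x)) :
    HasSum (fun m => (L : ℂ) * ((starRingEnd ℂ) (f m) * g (m + r)))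
      (∫ x in Set.Icc (-(L / 2)) (L / 2),
        charExp (r * x / L) * ((starRingEnd ℂ) (F x) * G x)) := by
  set H : ℤ × ℤ → ℝ → ℂ := fun q x =>
    (starRingEnd ℂ) (f q.1) * g q.2 * charExp (((r + q.1 - q.2 : ℤ) : ℝ) * x / L) with hH
  have hprod : ∀ x : ℝ, HasSum (fun q => H q x) (charExp (r * x / L) * ((starRingEnd ℂ) (F x) * G x)) :=
    fun x => by
      have hf' : HasSum (fun m => (starRingEnd ℂ) (f m) * charExp (m * x / L))
          ((starRingEnd ℂ) (F x)) := by
        have := Complex.hasSum_conj'.mpr (hF x)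
        simpa only [Function.comp_def, map_mul, conj_charExp, neg_neg] using this
      have h1 : Summable fun m => ‖(starRingEnd ℂ) (f m) * charExp (m * x / L)‖ := by
        simpa using hf
      have h2 : Summable fun m => ‖g m * charExp (-(m * x / L))‖ := by
        simpa using hg
      have h3 := hasSum_prod_mul h1 h2 hf' (hG x)
      refine (h3.mul_left (charExp (r * x / L))).congr_fun fun q => ?_
      simp only [hH]
      rw [show (((r + q.1 - q.2 : ℤ) : ℝ) * x / L) = r * x / L + (q.1 * x / L + -(q.2 * x / L)) by
        push_cast; ring, charExp_add, charExp_add]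
      ring
  have hcont : ∀ q, Continuous (H q) := fun q => by
    simp only [hH]
    fun_prop
  have hnorm : ∀ q x, ‖H q x‖ = ‖f q.1‖ * ‖g q.2‖ := fun q x => by
    simp [hH]
  have hint := MeasureTheory.hasSum_integral_of_summable_integral_norm (F := H)
    (μ := MeasureTheory.volume.restrict (Set.Icc (-(L / 2)) (L / 2)))
    (fun q => (hcont q).continuousOn.integrableOn_compact isCompact_Icc) (by
      simp only [hnorm, MeasureTheory.integral_const, smul_eq_mul]
      exact (summable_mul_of_summable_norm (f := fun m => ‖f m‖) (g := fun m => ‖g m‖)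
        (by simpa using hf) (by simpa using hg)).mul_left _)
  simp only [fun x => (hprod x).tsum_eq] at hint
  have hinj : Function.Injective (fun m : ℤ => (m, m + r)) := fun a b h => (Prod.ext_iff.mp h).1
  have hI : ∀ q, ∫ x in Set.Icc (-(L / 2)) (L / 2), H q x
      = (starRingEnd ℂ) (f q.1) * g q.2 * (if r + q.1 - q.2 = 0 then (L : ℂ) else 0) := fun q => by
    simp only [hH]
    rw [MeasureTheory.integral_const_mul, integral_charExp hL]
  simp only [hI] at hint
  -- Orthogonality leaves only the pairs `(m, m + r)`.
  rw [← hinj.hasSum_iff] at hint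
  · refine hint.congr_fun fun m => ?_
    simp only [Function.comp]
    rw [if_pos (by ring)]
    ring
  · intro q hq
    rw [if_neg, mul_zero]
    intro h
    exact hq ⟨q.1, Prod.ext rfl (by simp only; linarith)⟩

variable {d : ℕ}

theorem timeState_eq (k n : Idx d) :
    timeState d k n = (1 / (Real.sqrt d : ℂ)) * charExp (-(((k : ℤ) : ℝ) * ((n : ℤ) : ℝ) / d)) := by
  rw [timeState, charExp]
  congr 2
  push_cast
  ring

theorem timeState_mul_conj (hd : Odd d) (k n n' : Idx d) :
    timeState d k n * (starRingEnd ℂ) (timeState d k n')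
      = (1 / d : ℂ) * charExp (((k : ℤ) : ℝ) * (((n' : ℤ) : ℝ) - ((n : ℤ) : ℝ)) / d) := by
  have h0 : (0 : ℝ) < d := by exact_mod_cast hd.pos
  have h1 : (1 / (Real.sqrt d : ℂ)) * (1 / (Real.sqrt d : ℂ)) = 1 / d := by
    rw [div_mul_div_comm, one_mul, ← Complex.ofReal_mul, Real.mul_self_sqrt h0.le]
    simp
  rw [timeState_eq, timeState_eq, map_mul, conj_charExp, neg_neg, map_div₀, map_one,
    Complex.conj_ofReal, mul_mul_mul_comm, h1, ← charExp_add]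
  congr 2
  ring

/-- The prefactor of the Kraus operators. -/
noncomputable def krausNorm (d : ℕ) (σsq : ℝ) : ℝ :=
  1 / Real.sqrt (theta3 0 (2 * σsq / d)) * (1 / (d : ℝ) ^ (1 / 4 : ℝ))

theorem sqrt_mul_krausNorm_sq (hd : Odd d) {σsq : ℝ} (hσ : 0 < σsq) :
    Real.sqrt d * krausNorm d σsq ^ 2 = 1 / theta3 0 (2 * σsq / d) := by
  have h0 : (0 : ℝ) < d := by exact_mod_cast hd.pos
  have hθ := theta3_pos (by positivity : 0 < 2 * σsq / d) 0
  have h1 : ((d : ℝ) ^ (1 / 4 : ℝ)) ^ 2 = Real.sqrt d := by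
    rw [← Real.rpow_natCast, ← Real.rpow_mul h0.le, Real.sqrt_eq_rpow]
    norm_num
  rw [krausNorm, mul_pow, div_pow, div_pow, h1, Real.sq_sqrt hθ.le]
  have := Real.sqrt_pos.mpr h0
  field_simp

/-- The Kraus operators are superpositions of the cyclic shifts of the energy basis. -/
theorem hasSum_kraus_mulVec (hd : Odd d) {σsq : ℝ} (hσ : 0 < σsq) (x : ℝ) (v : Idx d → ℂ)
    (n : Idx d) :
    HasSum (fun m : ℤ => (krausNorm d σsq * gaussWeight (σsq / d) m : ℝ)
        * v (wrap hd ((n : ℤ) + -m)) * charExp (-(m * x / Real.sqrt d)))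
      ((kraus d σsq x).mulVec v n) := by
  have h0 : (0 : ℝ) < d := by exact_mod_cast hd.pos
  have h0' : (d : ℂ) ≠ 0 := by exact_mod_cast h0.ne'
  have hs : 0 < σsq / d := by positivity
  have hsq := Real.sqrt_pos.mpr h0
  have hss := Real.mul_self_sqrt h0.le
  have hc : ∀ k : Idx d, HasSum (fun m : ℤ => (krausNorm d σsq * gaussWeight (σsq / d) m : ℝ)
      * charExp (m * (((k : ℤ) : ℝ) / d)) * charExp (-(m * x / Real.sqrt d)))
      (krausCoeff d σsq x k : ℂ) := fun k => by
    have h1 := (hasSum_theta3 hs ((((k : ℤ) : ℝ) - x * Real.sqrt d) / d)).mul_left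
      (krausNorm d σsq : ℂ)
    rw [← Complex.ofReal_mul] at h1
    refine h1.congr_fun fun m => ?_
    have h2 : (m : ℝ) * ((((k : ℤ) : ℝ) - x * Real.sqrt d) / d)
        = m * (((k : ℤ) : ℝ) / d) + -(m * x / Real.sqrt d) := by
      have h3 : x * Real.sqrt d / d = x / Real.sqrt d := by
        field_simp
        rw [sq, hss]
      rw [sub_div, h3]
      ring
    rw [h2, charExp_add]
    push_cast
    ring
  have hv : (kraus d σsq x).mulVec v n = ∑ n' : Idx d, ∑ k : Idx d,
      (krausCoeff d σsq x k : ℂ) * ((1 / d : ℂ)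
        * charExp (((k : ℤ) : ℝ) * (((n' : ℤ) : ℝ) - ((n : ℤ) : ℝ)) / d)) * v n' := by
    rw [Matrix.mulVec, dotProduct]
    refine Finset.sum_congr rfl fun n' _ => ?_
    rw [kraus, Matrix.sum_apply, Finset.sum_mul]
    refine Finset.sum_congr rfl fun k _ => ?_
    rw [← timeState_mul_conj hd]
    simp [Matrix.vecMulVec_apply]
  rw [hv]
  refine (hasSum_sum fun n' _ => hasSum_sum fun k _ =>
    ((hc k).mul_right _).mul_right _).congr_fun fun m => ?_
  -- Summing over the time label forces `n' ≡ n - m` modulo `d`: the `m`-th Fourier mode in the time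
  -- basis is the energy shift by `m`.
  have hin : ∀ n' : Idx d, ∑ k : Idx d, charExp (m * (((k : ℤ) : ℝ) / d))
      * charExp (((k : ℤ) : ℝ) * (((n' : ℤ) : ℝ) - ((n : ℤ) : ℝ)) / d)
      = if n' = wrap hd ((n : ℤ) + -m) then (d : ℂ) else 0 := fun n' => by
    have h1 := sum_charExp hd ((n' : ℤ) - ((n : ℤ) + -m))
    simp only [← wrap_eq_wrap_iff hd, wrap_coe] at h1
    rw [← h1]
    refine Finset.sum_congr rfl fun k _ => ?_
    rw [← charExp_add]
    congr 1
    push_cast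
    ring
  calc _ = ∑ n' : Idx d, (krausNorm d σsq * gaussWeight (σsq / d) m : ℝ)
        * charExp (-(m * x / Real.sqrt d)) * (1 / d : ℂ) * v n'
        * (if n' = wrap hd ((n : ℤ) + -m) then (d : ℂ) else 0) := by
        simp only [mul_ite, mul_zero, Finset.sum_ite_eq', Finset.mem_univ, if_true]
        field_simp
    _ = _ := by
        refine Finset.sum_congr rfl fun n' _ => ?_
        rw [← hin, Finset.mul_sum]
        refine Finset.sum_congr rfl fun k _ => ?_
        ring

/-- The sesquilinear expression `⟨v, S^a G v⟩` for the cyclic shift `S` of the energy basis. -/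
noncomputable def shiftForm (hd : Odd d) (a : ℤ) (G : Idx d → ℝ) (v : Idx d → ℂ) : ℂ :=
  ∑ n : Idx d, (starRingEnd ℂ) (v (wrap hd ((n : ℤ) + a))) * v n * G n

theorem continuous_krausCoeff (hd : Odd d) {σsq : ℝ} (hσ : 0 < σsq) (k : Idx d) :
    Continuous fun x => krausCoeff d σsq x k := by
  have h0 : (0 : ℝ) < d := by exact_mod_cast hd.pos
  unfold krausCoeff
  have := continuous_theta3 (by positivity : 0 < σsq / d)
  fun_prop

theorem continuous_kraus_mulVec (hd : Odd d) {σsq : ℝ} (hσ : 0 < σsq) {X : Type*}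
    [TopologicalSpace X] {y : X → ℝ} {v : X → Idx d → ℂ} (hy : Continuous y) (hv : Continuous v) :
    Continuous fun x => (kraus d σsq (y x)).mulVec (v x) := by
  have hk : Continuous fun x => kraus d σsq (y x) := by
    unfold kraus
    refine continuous_finsetSum _ fun k _ => ?_
    have := (continuous_krausCoeff hd hσ k).comp hy
    exact (Complex.continuous_ofReal.comp this).smul continuous_const
  exact hk.matrix_mulVec hv

theorem continuous_shiftForm (hd : Odd d) (a : ℤ) (G : Idx d → ℝ) :
    Continuous (shiftForm hd a G) := by
  unfold shiftForm
  fun_prop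

theorem hasSum_integral_kraus (hd : Odd d) {σsq : ℝ} (hσ : 0 < σsq) (r : ℤ) (v : Idx d → ℂ)
    (n n' : Idx d) :
    HasSum (fun m : ℤ => ((1 / theta3 0 (2 * σsq / d) * (gaussWeight (σsq / d) m
        * gaussWeight (σsq / d) (m + r)) : ℝ) : ℂ)
        * ((starRingEnd ℂ) (v (wrap hd ((n : ℤ) + -m))) * v (wrap hd ((n' : ℤ) + -(m + r)))))
      (∫ x in Set.Icc (-(Real.sqrt d / 2)) (Real.sqrt d / 2), charExp (r * x / Real.sqrt d) *
        ((starRingEnd ℂ) ((kraus d σsq x).mulVec v n) * (kraus d σsq x).mulVec v n')) := by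
  have h0 : (0 : ℝ) < d := by exact_mod_cast hd.pos
  have hs : 0 < σsq / d := by positivity
  have hsum : ∀ n : Idx d, Summable fun m : ℤ =>
      ‖((krausNorm d σsq * gaussWeight (σsq / d) m : ℝ) : ℂ) * v (wrap hd ((n : ℤ) + -m))‖ :=
    fun n => by
      refine Summable.of_nonneg_of_le (fun _ => norm_nonneg _) (fun m => ?_)
        ((summable_gaussWeight hs).mul_left (|krausNorm d σsq| * ∑ p, ‖v p‖))
      rw [norm_mul, Complex.norm_real, Real.norm_eq_abs, abs_mul,
        abs_of_pos (gaussWeight_pos _ _), mul_right_comm]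
      refine mul_le_mul_of_nonneg_right (mul_le_mul_of_nonneg_left ?_ (abs_nonneg _))
        (gaussWeight_pos _ _).le
      exact Finset.single_le_sum (f := fun p => ‖v p‖) (fun p _ => norm_nonneg _)
        (Finset.mem_univ _)
  have h := hasSum_integral_mul (Real.sqrt_pos.mpr h0) r (hsum n) (hsum n')
    (fun x => hasSum_kraus_mulVec hd hσ x v n) (fun x => hasSum_kraus_mulVec hd hσ x v n')
  refine h.congr_fun fun m => ?_
  rw [← sqrt_mul_krausNorm_sq hd hσ, map_mul, Complex.conj_ofReal]
  push_cast
  ring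

theorem integrableOn_kraus (hd : Odd d) {σsq : ℝ} (hσ : 0 < σsq) (r : ℤ) (v : Idx d → ℂ)
    (n n' : Idx d) :
    MeasureTheory.IntegrableOn (fun x => charExp (r * x / Real.sqrt d) *
        ((starRingEnd ℂ) ((kraus d σsq x).mulVec v n) * (kraus d σsq x).mulVec v n'))
      (Set.Icc (-(Real.sqrt d / 2)) (Real.sqrt d / 2)) := by
  refine Continuous.integrableOn_Icc ?_
  have h := continuous_kraus_mulVec hd hσ continuous_id (continuous_const (y := v))
  have h1 := (continuous_apply n).comp h
  have h2 := (continuous_apply n').comp h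
  simp only [Function.comp_def, id] at h1 h2
  fun_prop

/-- Unread measurement is a random energy shift: the two shifts in the sesquilinear form coincide
after integration, with probability weight the squared Gaussian. They commute with the shift by `a`,
so only `G` is averaged. -/
theorem integral_shiftForm_kraus (hd : Odd d) {σsq : ℝ} (hσ : 0 < σsq) (a : ℤ) (G : Idx d → ℝ)
    (v : Idx d → ℂ) :
    ∫ x in Set.Icc (-(Real.sqrt d / 2)) (Real.sqrt d / 2),
        shiftForm hd a G ((kraus d σsq x).mulVec v) = shiftForm hd a (transition d σsq G) v := by
  have h1 : ∫ x in Set.Icc (-(Real.sqrt d / 2)) (Real.sqrt d / 2),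
        shiftForm hd a G ((kraus d σsq x).mulVec v)
      = ∑ n : Idx d, (∫ x in Set.Icc (-(Real.sqrt d / 2)) (Real.sqrt d / 2),
        charExp ((0 : ℤ) * x / Real.sqrt d) *
        ((starRingEnd ℂ) ((kraus d σsq x).mulVec v (wrap hd ((n : ℤ) + a)))
          * (kraus d σsq x).mulVec v n)) * G n := by
    simp only [shiftForm]
    rw [MeasureTheory.integral_finsetSum]
    · refine Finset.sum_congr rfl fun n _ => ?_
      rw [MeasureTheory.integral_mul_const]
      simp
    · intro n _
      refine MeasureTheory.Integrable.mul_const ?_ _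
      have := integrableOn_kraus hd hσ 0 v (wrap hd ((n : ℤ) + a)) n
      simp only [Int.cast_zero, zero_mul, zero_div, charExp_zero, one_mul] at this
      exact this
  rw [h1]
  refine (hasSum_sum fun (n : Idx d) _ => (hasSum_integral_kraus hd hσ 0 v
    (wrap hd ((n : ℤ) + a)) n).mul_right (G n : ℂ)).unique ?_
  have h2 : ∀ p : Idx d, HasSum (fun m : ℤ =>
      (starRingEnd ℂ) (v (wrap hd ((p : ℤ) + a))) * v p *
        ((1 / theta3 0 (2 * σsq / d) * gaussWeight (2 * σsq / d) m * G (wrap hd (p + m)) : ℝ) : ℂ))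
      ((starRingEnd ℂ) (v (wrap hd ((p : ℤ) + a))) * v p * (transition d σsq G p : ℂ)) := fun p =>
    (Complex.hasSum_ofReal.mpr (hasSum_transition hd hσ G p)).mul_left _
  refine (hasSum_sum fun p _ => h2 p).congr_fun fun m => ?_
  rw [← (shiftEquiv hd m).sum_comp]
  refine Finset.sum_congr rfl fun p _ => ?_
  have hg : gaussWeight (σsq / d) m * gaussWeight (σsq / d) (m + 0)
      = gaussWeight (2 * σsq / d) m := by
    rw [add_zero, ← sq, gaussWeight_sq, mul_div_assoc]
  rw [hg, shiftEquiv_apply, add_zero, wrap_wrap_add, wrap_wrap_add, add_assoc, wrap_wrap_add,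
    show (p : ℤ) + m + (a + -m) = p + a by ring, show (p : ℤ) + m + -m = p by ring, wrap_coe]
  push_cast
  ring

/-- The first Fourier coefficient of the outcome distribution for a fixed label. -/
noncomputable def outcomeCoeff (d : ℕ) (σsq : ℝ) : ℝ :=
  ∑' m : ℤ, 1 / theta3 0 (2 * σsq / d) * (gaussWeight (σsq / d) m * gaussWeight (σsq / d) (m + 1))

theorem summable_outcomeCoeff (hd : Odd d) {σsq : ℝ} (hσ : 0 < σsq) :
    Summable fun m : ℤ => 1 / theta3 0 (2 * σsq / d)
      * (gaussWeight (σsq / d) m * gaussWeight (σsq / d) (m + 1)) := by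
  have h0 : (0 : ℝ) < d := by exact_mod_cast hd.pos
  have hs : 0 < σsq / d := by positivity
  refine (Summable.of_nonneg_of_le
    (fun m => (mul_pos (gaussWeight_pos _ _) (gaussWeight_pos _ _)).le) (fun m => ?_)
    (summable_gaussWeight hs)).mul_left _
  refine mul_le_of_le_one_right (gaussWeight_pos _ _).le ?_
  rw [gaussWeight, Real.exp_le_one_iff, neg_nonpos]
  have := Real.pi_pos
  positivity

/-- Neighbouring weights satisfy `w w' ≤ (w² + w'²) / 2`, and both sums of squares equal the
normalising theta value. -/
theorem abs_outcomeCoeff_le (hd : Odd d) {σsq : ℝ} (hσ : 0 < σsq) :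
    |outcomeCoeff d σsq| ≤ 1 := by
  have h0 : (0 : ℝ) < d := by exact_mod_cast hd.pos
  have hs : 0 < 2 * σsq / d := by positivity
  have hθ := theta3_pos hs 0
  rw [outcomeCoeff, abs_of_nonneg (tsum_nonneg fun m => (mul_pos (one_div_pos.mpr hθ)
    (mul_pos (gaussWeight_pos _ _) (gaussWeight_pos _ _))).le)]
  have h1 := hasSum_theta3_zero hs
  have h2 := (Equiv.addRight (1 : ℤ)).hasSum_iff.mpr h1
  have h3 := ((h1.add h2).mul_left (1 / 2)).mul_left (1 / theta3 0 (2 * σsq / d))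
  have h4 := hasSum_le (fun m => ?_) (summable_outcomeCoeff hd hσ).hasSum h3
  · refine h4.trans (le_of_eq ?_)
    field_simp
    norm_num
  · refine mul_le_mul_of_nonneg_left ?_ (one_div_pos.mpr hθ).le
    simp only [Function.comp, Equiv.coe_addRight]
    rw [mul_div_assoc, ← gaussWeight_sq, ← gaussWeight_sq]
    nlinarith [sq_nonneg (gaussWeight (σsq / d) m - gaussWeight (σsq / d) (m + 1))]

/-- The character offsets the two energy shifts by one, so the squared norm becomes a
nearest-neighbour correlation and the weights factor out as a scalar. -/
theorem integral_charExp_mul_shiftForm_kraus (hd : Odd d) {σsq : ℝ} (hσ : 0 < σsq)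
    (v : Idx d → ℂ) :
    ∫ x in Set.Icc (-(Real.sqrt d / 2)) (Real.sqrt d / 2), charExp (x / Real.sqrt d) *
        shiftForm hd 0 (fun _ => 1) ((kraus d σsq x).mulVec v)
      = outcomeCoeff d σsq * shiftForm hd 1 (fun _ => 1) v := by
  have h1 : ∫ x in Set.Icc (-(Real.sqrt d / 2)) (Real.sqrt d / 2), charExp (x / Real.sqrt d) *
        shiftForm hd 0 (fun _ => 1) ((kraus d σsq x).mulVec v)
      = ∑ n : Idx d, ∫ x in Set.Icc (-(Real.sqrt d / 2)) (Real.sqrt d / 2),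
        charExp ((1 : ℤ) * x / Real.sqrt d) *
        ((starRingEnd ℂ) ((kraus d σsq x).mulVec v n) * (kraus d σsq x).mulVec v n) := by
    rw [← MeasureTheory.integral_finsetSum]
    · simp [shiftForm, wrap_coe, Finset.mul_sum]
    · intro n _
      exact integrableOn_kraus hd hσ 1 v n n
  rw [h1]
  refine (hasSum_sum fun n _ => hasSum_integral_kraus hd hσ 1 v n n).unique ?_
  have h2 := (Complex.hasSum_ofReal.mpr (summable_outcomeCoeff hd hσ).hasSum).mul_right
    (shiftForm hd 1 (fun _ => 1) v)
  refine h2.congr_fun fun m => ?_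
  rw [← (shiftEquiv hd (m + 1)).sum_comp, shiftForm, Finset.mul_sum]
  refine Finset.sum_congr rfl fun p _ => ?_
  rw [shiftEquiv_apply, wrap_wrap_add, wrap_wrap_add,
    show (p : ℤ) + (m + 1) + -m = p + 1 by ring,
    show (p : ℤ) + (m + 1) + -(m + 1) = p by ring, wrap_coe]
  push_cast
  ring

theorem evolution_mulVec (hd : Odd d) (v : Idx d → ℂ) (n : Idx d) :
    (evolution d (1 / 2 / Real.sqrt d)).mulVec v n
      = charExp (-(((n : ℤ) : ℝ) / (2 * d))) * v n := by
  have h0 : (0 : ℝ) < d := by exact_mod_cast hd.pos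
  have hss : (Real.sqrt d : ℂ) * Real.sqrt d = d := by
    rw [← Complex.ofReal_mul, Real.mul_self_sqrt h0.le]
    simp
  have hsq : (Real.sqrt d : ℂ) ≠ 0 := by exact_mod_cast (Real.sqrt_pos.mpr h0).ne'
  have h0' : (d : ℂ) ≠ 0 := by exact_mod_cast h0.ne'
  rw [evolution, hamiltonian, ← Matrix.diagonal_smul, Matrix.exp_diagonal, Matrix.mulVec_diagonal,
    Pi.coe_exp, ← Complex.exp_eq_exp_ℂ, charExp]
  congr 2
  simp only [Pi.smul_apply, smul_eq_mul]
  push_cast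
  field_simp
  rw [sq, hss]
  field_simp

theorem wrap_add_one_sub (hd : Odd d) (n : Idx d) :
    ((wrap hd ((n : ℤ) + 1) : ℤ) : ℝ) - ((n : ℤ) : ℝ)
      = 1 - d * (if n = lastLabel hd then 1 else 0) := by
  have h := (mem_idx_iff hd n).mp n.2
  have hz : (wrap hd ((n : ℤ) + 1) : ℤ) - (n : ℤ)
      = 1 - d * (if n = lastLabel hd then 1 else 0) := by
    simp only [Subtype.ext_iff, lastLabel, wrap]
    split_ifs with hn
    · have h1 : (n : ℤ) + 1 + ((d : ℤ) - 1) / 2 = d := by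
        rw [hn]
        obtain ⟨e, rfl⟩ := hd
        push_cast
        omega
      rw [h1, Int.emod_self]
      obtain ⟨e, rfl⟩ := hd
      push_cast at *
      omega
    · rw [Int.emod_eq_of_lt]
      · ring
      · omega
      · obtain ⟨e, rfl⟩ := hd
        push_cast at *
        omega
  exact_mod_cast hz

theorem shiftForm_zero_evolution (hd : Odd d) (G : Idx d → ℝ) (v : Idx d → ℂ) :
    shiftForm hd 0 G ((evolution d (1 / 2 / Real.sqrt d)).mulVec v) = shiftForm hd 0 G v := by
  simp only [shiftForm, add_zero, wrap_coe]
  refine Finset.sum_congr rfl fun n _ => ?_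
  rw [evolution_mulVec hd, map_mul, conj_charExp, mul_mul_mul_comm, charExp_neg_mul_self, one_mul]

theorem charExp_neg_half : charExp (-(1 / 2)) = -1 := by
  rw [charExp, show (2 * Real.pi * Complex.I * ((-(1 / 2) : ℝ) : ℂ)) = -(Real.pi * Complex.I) by
    push_cast; ring, Complex.exp_neg, Complex.exp_pi_mul_I]
  norm_num

/-- Neighbouring labels differ by 1, except at the wrap-around, where the difference is `1 - d`. The
surplus phase there is `exp (-iπ) = -1`, which is exactly the hit factor with `c = 2`. -/
theorem shiftForm_one_evolution (hd : Odd d) (G : Idx d → ℝ) (v : Idx d → ℂ) :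
    shiftForm hd 1 G ((evolution d (1 / 2 / Real.sqrt d)).mulVec v)
      = charExp (1 / (2 * d)) * shiftForm hd 1 (fun n => hitFactor hd 2 n * G n) v := by
  have h0 : (d : ℝ) ≠ 0 := by exact_mod_cast hd.pos.ne'
  simp only [shiftForm, Finset.mul_sum]
  refine Finset.sum_congr rfl fun n _ => ?_
  have h1 : charExp (((wrap hd ((n : ℤ) + 1) : ℤ) : ℝ) / (2 * d))
      * charExp (-(((n : ℤ) : ℝ) / (2 * d))) = charExp (1 / (2 * d)) * (hitFactor hd 2 n : ℂ) := by
    rw [← charExp_add, ← sub_eq_add_neg, ← sub_div, wrap_add_one_sub, hitFactor]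
    split_ifs
    · rw [show (1 - (d : ℝ) * 1) / (2 * d) = 1 / (2 * d) + -(1 / 2) by field_simp; ring,
        charExp_add, charExp_neg_half]
      push_cast
      ring
    · simp
  rw [evolution_mulVec hd, evolution_mulVec hd, map_mul, conj_charExp, neg_neg, mul_mul_mul_comm,
    h1]
  push_cast
  ring

end QuasiIdealClock
-- Normalisation of the initial state and iteration over the measurements.
namespace QuasiIdealClock

variable {d : ℕ}

theorem charExp_half_odd (k : ℤ) : charExp (((2 * k + 1 : ℤ) : ℝ) / 2) = -1 := by
  rw [← charExp_neg_half, ← charExp_add_int (-(1 / 2)) (k + 1)]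
  congr 1
  push_cast
  ring

theorem charExp_half_even (k : ℤ) : charExp (((2 * k : ℤ) : ℝ) / 2) = 1 := by
  rw [← charExp_int k]
  congr 1
  push_cast
  ring

theorem hasSum_theta3_mul {s t : ℝ} (hs : 0 < s) (ht : 0 < t) (z w : ℝ) :
    HasSum (fun q : ℤ × ℤ => ((gaussWeight s q.1 * gaussWeight t q.2 : ℝ) : ℂ)
      * charExp (q.1 * z + q.2 * w)) (theta3 z s * theta3 w t : ℂ) := by
  have hn : ∀ {s : ℝ} (_ : 0 < s) (z : ℝ),
      Summable fun m : ℤ => ‖(gaussWeight s m : ℂ) * charExp (m * z)‖ := fun hs z => by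
    simpa [abs_of_pos (gaussWeight_pos _ _)] using summable_gaussWeight hs
  refine (hasSum_prod_mul (hn hs z) (hn ht w) (hasSum_theta3 hs z)
    (hasSum_theta3 ht w)).congr_fun fun q => ?_
  rw [charExp_add]
  push_cast
  ring

/-- The normalisation of the quasi-ideal states. -/
theorem sum_theta3_sq (hd : Odd d) {ξsq : ℝ} (hξ : 0 < ξsq) :
    2 * ∑ k : Idx d, theta3 (((k : ℤ) : ℝ) / d) (ξsq / d) ^ 2
      = d * (theta3 0 (ξsq / (2 * d)) * theta3 0 (d * ξsq / 2)
        + theta3 (1 / 2) (ξsq / (2 * d)) * theta3 (d / 2) (d * ξsq / 2)) := by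
  have h0 : (0 : ℝ) < d := by exact_mod_cast hd.pos
  have hdz : (d : ℤ) ≠ 0 := by exact_mod_cast hd.pos.ne'
  have hs : 0 < ξsq / d := by positivity
  have hs1 : 0 < ξsq / (2 * d) := by positivity
  have hs2 : 0 < d * ξsq / 2 := by positivity
  -- On the left only pairs `(a, db - a)` survive the sum over labels. The identity `a² + (db - a)²
  -- = ((2a - db)² + (db)²) / 2` maps them to pairs `(u, v) = (2a - db, b)`, which are those with `u
  -- + dv` even; the factor `1 + (-1)^(u + dv)` on the right selects these and yields the factor 2.
  have hL : HasSum (fun q : ℤ × ℤ => ((gaussWeight (ξsq / d) q.1 * gaussWeight (ξsq / d) q.2 : ℝ) : ℂ)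
      * (if (d : ℤ) ∣ q.1 + q.2 then (d : ℂ) else 0))
      ((∑ k : Idx d, theta3 (((k : ℤ) : ℝ) / d) (ξsq / d) ^ 2 : ℝ) : ℂ) := by
    push_cast
    simp only [sq]
    refine (hasSum_sum fun (k : Idx d) _ => hasSum_theta3_mul hs hs (((k : ℤ) : ℝ) / d)
      (((k : ℤ) : ℝ) / d)).congr_fun fun q => ?_
    rw [← sum_charExp hd, Finset.mul_sum]
    refine Finset.sum_congr rfl fun k _ => ?_
    rw [← Complex.ofReal_mul]
    congr 2
    push_cast
    ring
  have hR : HasSum (fun q : ℤ × ℤ =>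
      ((gaussWeight (ξsq / (2 * d)) q.1 * gaussWeight (d * ξsq / 2) q.2 : ℝ) : ℂ)
      * (1 + charExp (((q.1 + d * q.2 : ℤ) : ℝ) / 2)))
      ((theta3 0 (ξsq / (2 * d)) * theta3 0 (d * ξsq / 2)
        + theta3 (1 / 2) (ξsq / (2 * d)) * theta3 (d / 2) (d * ξsq / 2) : ℝ) : ℂ) := by
    push_cast
    refine ((hasSum_theta3_mul hs1 hs2 0 0).add
      (hasSum_theta3_mul hs1 hs2 (1 / 2) (d / 2))).congr_fun fun q => ?_
    simp only [mul_zero, add_zero, charExp_zero]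
    rw [← mul_add]
    rw [← Complex.ofReal_mul]
    congr 3
    ring
  have hinj1 : Function.Injective (fun q : ℤ × ℤ => (q.1, d * q.2 - q.1)) := by
    rintro ⟨a, b⟩ ⟨a', b'⟩ h
    simp only [Prod.mk.injEq] at h
    obtain ⟨rfl, h⟩ := h
    simpa using mul_left_cancel₀ hdz (sub_left_injective h)
  have hinj2 : Function.Injective (fun q : ℤ × ℤ => (2 * q.1 - d * q.2, q.2)) := by
    rintro ⟨a, b⟩ ⟨a', b'⟩ h
    simp only [Prod.mk.injEq] at h
    obtain ⟨h, rfl⟩ := h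
    simpa using h
  rw [← hinj1.hasSum_iff] at hL
  · rw [← hinj2.hasSum_iff] at hR
    · have h3 := (hL.mul_left (2 : ℂ)).unique ((hR.mul_left (d : ℂ)).congr_fun fun q => ?_)
      · exact_mod_cast h3
      · simp only [Function.comp]
        rw [if_pos ⟨q.2, by ring⟩, show (2 * q.1 - d * q.2 + d * q.2 : ℤ) = 2 * q.1 by ring,
          charExp_half_even]
        have hg : gaussWeight (ξsq / d) q.1 * gaussWeight (ξsq / d) (d * q.2 - q.1)
            = gaussWeight (ξsq / (2 * d)) (2 * q.1 - d * q.2)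
              * gaussWeight (d * ξsq / 2) q.2 := by
          simp only [gaussWeight]
          rw [← Real.exp_add, ← Real.exp_add]
          congr 1
          push_cast
          field_simp
          ring
        rw [hg]
        ring
    · rintro ⟨u, v⟩ hq
      rcases Int.even_or_odd' (u + d * v) with ⟨k, hk | hk⟩
      · exact absurd ⟨(k, v), Prod.ext (by simp only; linarith) rfl⟩ hq
      · simp only
        rw [hk, charExp_half_odd]
        simp
  · rintro ⟨u, v⟩ hq
    rw [if_neg, mul_zero]
    rintro ⟨k, hk⟩
    exact hq ⟨(u, k), Prod.ext rfl (by simp only at *; linarith)⟩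

theorem sum_norm_sq_amplitude (hd : Odd d) {ξsq : ℝ} (hξ : 0 < ξsq) (n₀ : ℤ) :
    ∑ k : Idx d, ‖amplitude d ξsq n₀ k‖ ^ 2 = 1 := by
  have h0 : (0 : ℝ) < d := by exact_mod_cast hd.pos
  have h1 := sum_theta3_sq hd hξ
  set N := theta3 0 (ξsq / (2 * d)) * theta3 0 (d * ξsq / 2)
        + theta3 (1 / 2) (ξsq / (2 * d)) * theta3 (d / 2) (d * ξsq / 2) with hN
  have hpos : 0 < ∑ k : Idx d, theta3 (((k : ℤ) : ℝ) / d) (ξsq / d) ^ 2 :=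
    Finset.sum_pos (fun k _ => pow_pos (theta3_pos (by positivity) _) 2) ⟨wrap hd 0, by simp⟩
  have hN0 : 0 < N := pos_of_mul_pos_right (h1 ▸ by positivity : 0 < (d : ℝ) * N) h0.le
  have h2 : ∀ k : Idx d, ‖amplitude d ξsq n₀ k‖ ^ 2
      = 2 / d / N * theta3 (((k : ℤ) : ℝ) / d) (ξsq / d) ^ 2 := fun k => by
    have h3 : Complex.exp (2 * Real.pi * Complex.I * (n₀ : ℂ) * ((k : ℤ) : ℂ) / (d : ℂ))
        = charExp (n₀ * ((k : ℤ) : ℝ) / d) := by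
      rw [charExp]
      congr 1
      push_cast
      ring
    rw [amplitude, h3, norm_mul, norm_charExp, mul_one, Complex.norm_real, Real.norm_eq_abs,
      sq_abs, mul_pow, div_pow, ← hN, Real.sq_sqrt (by positivity), Real.sq_sqrt hN0.le]
  simp only [h2, ← Finset.mul_sum]
  field_simp
  linarith

theorem shiftForm_zero_one (hd : Odd d) (v : Idx d → ℂ) :
    shiftForm hd 0 (fun _ => 1) v = ((∑ n, ‖v n‖ ^ 2 : ℝ) : ℂ) := by
  simp only [shiftForm, add_zero, wrap_coe]
  push_cast
  refine Finset.sum_congr rfl fun n _ => ?_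
  rw [mul_one, Complex.conj_mul']

theorem sum_norm_sq_initialState (hd : Odd d) {ξsq : ℝ} (hξ : 0 < ξsq) (n₀ : ℤ) :
    ∑ n : Idx d, ‖initialState d ξsq n₀ n‖ ^ 2 = 1 := by
  have h0' : (d : ℂ) ≠ 0 := by exact_mod_cast hd.pos.ne'
  have horth : ∀ k k' : Idx d, ∑ n : Idx d, timeState d k' n * (starRingEnd ℂ) (timeState d k n)
      = if k = k' then 1 else 0 := fun k k' => by
    have h1 : ∀ n : Idx d, timeState d k' n * (starRingEnd ℂ) (timeState d k n)
        = (1 / d : ℂ) * charExp (((n : ℤ) : ℝ) * (((k : ℤ) : ℝ) - ((k' : ℤ) : ℝ)) / d) := fun n => by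
      have h2 : ∀ a b : Idx d, timeState d a b = timeState d b a := fun a b => by
        rw [timeState_eq, timeState_eq, mul_comm ((a : ℤ) : ℝ)]
      rw [h2 k', h2 k, timeState_mul_conj hd]
    simp only [h1, ← Finset.mul_sum, sum_charExp_sub hd]
    split_ifs <;> simp [h0']
  have h1 := shiftForm_zero_one hd (initialState d ξsq n₀)
  have h2 : shiftForm hd 0 (fun _ => 1) (initialState d ξsq n₀)
      = ∑ k : Idx d, ∑ k' : Idx d, (starRingEnd ℂ) (amplitude d ξsq n₀ k) * amplitude d ξsq n₀ k'
        * ∑ n : Idx d, timeState d k' n * (starRingEnd ℂ) (timeState d k n) := by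
    simp only [shiftForm, add_zero, wrap_coe, initialState, Finset.sum_apply, Pi.smul_apply,
      smul_eq_mul, map_sum, map_mul, Complex.ofReal_one, mul_one, Finset.sum_mul_sum]
    simp only [Finset.mul_sum]
    rw [Finset.sum_comm]
    refine Finset.sum_congr rfl fun k _ => ?_
    rw [Finset.sum_comm]
    refine Finset.sum_congr rfl fun k' _ => Finset.sum_congr rfl fun n _ => ?_
    ring
  simp only [horth, mul_ite, mul_one, mul_zero, Finset.sum_ite_eq, Finset.mem_univ, if_true,
    Complex.conj_mul'] at h2
  rw [h2] at h1
  rw [← sum_norm_sq_amplitude hd hξ n₀]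
  exact_mod_cast h1.symm

/-- The cyclic shift permutes the labels, so the inequality of arithmetic and geometric means
applied to each product suffices. -/
theorem norm_shiftForm_one_le (hd : Odd d) {G : Idx d → ℝ} {M : ℝ} (hG : ∀ n, |G n| ≤ M)
    (v : Idx d → ℂ) : ‖shiftForm hd 1 G v‖ ≤ M * ∑ n, ‖v n‖ ^ 2 := by
  have hshift := (shiftEquiv hd 1).sum_comp (fun n => ‖v n‖ ^ 2)
  simp only [shiftEquiv_apply] at hshift
  have hM : ∀ n : Idx d, ‖(starRingEnd ℂ) (v (wrap hd ((n : ℤ) + 1))) * v n * G n‖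
      ≤ M * (1 / 2 * ‖v (wrap hd ((n : ℤ) + 1))‖ ^ 2 + 1 / 2 * ‖v n‖ ^ 2) := fun n => by
    rw [norm_mul, norm_mul, RCLike.norm_conj, Complex.norm_real, Real.norm_eq_abs, mul_comm]
    refine mul_le_mul (hG n) ?_ (by positivity) ((abs_nonneg _).trans (hG n))
    nlinarith [sq_nonneg (‖v (wrap hd ((n : ℤ) + 1))‖ - ‖v n‖)]
  refine (norm_sum_le _ _).trans ((Finset.sum_le_sum fun n _ => hM n).trans (le_of_eq ?_))
  rw [← Finset.mul_sum, Finset.sum_add_distrib, ← Finset.mul_sum, ← Finset.mul_sum, hshift]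
  ring

/-- Integration over a cube, the last coordinate first. -/
theorem setIntegral_pi_snoc {J : ℕ} {S : Set ℝ} (hS : IsCompact S)
    {F : (Fin (J + 1) → ℝ) → ℂ} (hF : Continuous F) :
    ∫ x in Set.pi Set.univ (fun _ : Fin (J + 1) => S), F x
      = ∫ x in Set.pi Set.univ (fun _ : Fin J => S), ∫ y in S,
        F (Fin.snoc (α := fun _ => ℝ) x y) := by
  have he := (MeasureTheory.volume_preserving_piFinSuccAbove (fun _ : Fin (J + 1) => ℝ)
    (Fin.last J)).symm
  rw [← he.setIntegral_preimage_emb (MeasurableEquiv.measurableEmbedding _)]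
  have hpre : (MeasurableEquiv.piFinSuccAbove (fun _ : Fin (J + 1) => ℝ) (Fin.last J)).symm ⁻¹'
      (Set.pi Set.univ fun _ => S) = S ×ˢ Set.pi Set.univ (fun _ : Fin J => S) := by
    ext q
    simp [Set.mem_pi, Fin.forall_fin_succ', MeasurableEquiv.piFinSuccAbove_symm_apply,
      Fin.insertNthEquiv, and_comm]
  have hval : ∀ q : ℝ × (Fin J → ℝ),
      (MeasurableEquiv.piFinSuccAbove (fun _ : Fin (J + 1) => ℝ) (Fin.last J)).symm q
        = Fin.snoc (α := fun _ => ℝ) q.2 q.1 := fun q => by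
    simp [MeasurableEquiv.piFinSuccAbove_symm_apply, Fin.insertNthEquiv, Fin.insertNth_last']
  simp only [hpre, hval]
  have hc : Continuous fun q : ℝ × (Fin J → ℝ) => F (Fin.snoc (α := fun _ => ℝ) q.2 q.1) :=
    hF.comp (Continuous.finSnoc continuous_snd continuous_fst)
  have hint := hc.continuousOn.integrableOn_compact (μ := MeasureTheory.volume)
    (hS.prod (isCompact_univ_pi fun _ : Fin J => hS))
  rw [MeasureTheory.IntegrableOn, MeasureTheory.Measure.volume_eq_prod,
    ← MeasureTheory.Measure.prod_restrict] at hint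
  rw [MeasureTheory.Measure.volume_eq_prod, ← MeasureTheory.Measure.prod_restrict,
    MeasureTheory.integral_prod_symm _ hint]

theorem continuous_postState (hd : Odd d) (ξsq : ℝ) {σsq : ℝ} (hσ : 0 < σsq) (δ : ℝ) (n₀ : ℤ)
    (J : ℕ) : Continuous (postState d ξsq σsq δ n₀ J) := by
  induction J with
  | zero => exact continuous_const
  | succ J ih =>
    refine continuous_kraus_mulVec hd hσ (continuous_apply (Fin.last J)) ?_
    exact continuous_const.matrix_mulVec (ih.comp (by fun_prop))

theorem postState_snoc (ξsq σsq δ : ℝ) (n₀ : ℤ) (J : ℕ) (x : Fin J → ℝ) (y : ℝ) :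
    postState d ξsq σsq δ n₀ (J + 1) (Fin.snoc (α := fun _ => ℝ) x y)
      = (kraus d σsq y).mulVec
        ((evolution d (δ / Real.sqrt d)).mulVec (postState d ξsq σsq δ n₀ J x)) := by
  simp only [postState, Fin.snoc_last, Fin.snoc_castSucc]

theorem outcomeDensity_eq (hd : Odd d) (ξsq σsq δ : ℝ) (n₀ : ℤ) (J : ℕ) (x : Fin J → ℝ) :
    (outcomeDensity d ξsq σsq δ n₀ J x : ℂ)
      = shiftForm hd 0 (fun _ => 1) (postState d ξsq σsq δ n₀ J x) := by
  rw [outcomeDensity, EuclideanSpace.norm_sq_eq, shiftForm_zero_one]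

theorem outcomeCharacter_eq (hd : Odd d) (ξsq σsq δ : ℝ) (n₀ : ℤ) (J : ℕ) (i : Fin J) :
    outcomeCharacter d ξsq σsq δ n₀ J i
      = ∫ x in Set.pi Set.univ
          (fun _ : Fin J => Set.Icc (-(Real.sqrt d / 2)) (Real.sqrt d / 2)),
        charExp (x i / Real.sqrt d)
          * shiftForm hd 0 (fun _ => 1) (postState d ξsq σsq δ n₀ J x) := by
  simp only [outcomeCharacter, outcomeDensity_eq hd, charExp, Complex.ofReal_div, mul_div_assoc]

theorem continuous_outcomeIntegrand (hd : Odd d) (ξsq : ℝ) {σsq : ℝ} (hσ : 0 < σsq) (δ : ℝ)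
    (n₀ : ℤ) (J : ℕ) (i : Fin J) :
    Continuous fun x : Fin J → ℝ => charExp (x i / Real.sqrt d)
      * shiftForm hd 0 (fun _ => 1) (postState d ξsq σsq δ n₀ J x) := by
  have h := (continuous_shiftForm hd 0 fun _ => 1).comp (continuous_postState hd ξsq hσ δ n₀ J)
  simp only [Function.comp_def] at h
  fun_prop

/-- Later measurements do not influence the statistics of an outcome. -/
theorem outcomeCharacter_castSucc (hd : Odd d) (ξsq : ℝ) {σsq : ℝ} (hσ : 0 < σsq) (n₀ : ℤ)
    (J : ℕ) (i : Fin J) :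
    outcomeCharacter d ξsq σsq (1 / 2) n₀ (J + 1) i.castSucc
      = outcomeCharacter d ξsq σsq (1 / 2) n₀ J i := by
  rw [outcomeCharacter_eq hd, outcomeCharacter_eq hd, setIntegral_pi_snoc isCompact_Icc
    (continuous_outcomeIntegrand hd ξsq hσ (1 / 2) n₀ (J + 1) i.castSucc)]
  simp only [postState_snoc, Fin.snoc_castSucc]
  congr 1
  funext x
  rw [MeasureTheory.integral_const_mul, integral_shiftForm_kraus hd hσ,
    funext (transition_const hd hσ 1), shiftForm_zero_evolution]

theorem outcomeCharacter_last (hd : Odd d) (ξsq : ℝ) {σsq : ℝ} (hσ : 0 < σsq) (n₀ : ℤ) (J : ℕ) :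
    outcomeCharacter d ξsq σsq (1 / 2) n₀ (J + 1) (Fin.last J)
      = outcomeCoeff d σsq * ∫ x in Set.pi Set.univ
          (fun _ : Fin J => Set.Icc (-(Real.sqrt d / 2)) (Real.sqrt d / 2)),
        shiftForm hd 1 (fun _ => 1) ((evolution d (1 / 2 / Real.sqrt d)).mulVec
          (postState d ξsq σsq (1 / 2) n₀ J x)) := by
  rw [outcomeCharacter_eq hd, setIntegral_pi_snoc isCompact_Icc
    (continuous_outcomeIntegrand hd ξsq hσ (1 / 2) n₀ (J + 1) (Fin.last J))]
  simp only [postState_snoc, Fin.snoc_last]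
  rw [← MeasureTheory.integral_const_mul]
  congr 1
  funext x
  exact integral_charExp_mul_shiftForm_kraus hd hσ _

/-- One step of the evolution of an observable: free evolution, then measurement. -/
noncomputable def heisenbergStep (hd : Odd d) (σsq : ℝ) (G : Idx d → ℝ) : Idx d → ℝ :=
  transition d σsq fun n => hitFactor hd 2 n * G n

/-- Pulling the observable back through `J` unread measurements and `J + 1` evolutions. The
outermost sign belongs to the first evolution, which acts directly on the initial state. -/
theorem integral_shiftForm_postState (hd : Odd d) (ξsq : ℝ) {σsq : ℝ} (hσ : 0 < σsq) (n₀ : ℤ)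
    (J : ℕ) (G : Idx d → ℝ) :
    ∫ x in Set.pi Set.univ
          (fun _ : Fin J => Set.Icc (-(Real.sqrt d / 2)) (Real.sqrt d / 2)),
        shiftForm hd 1 G ((evolution d (1 / 2 / Real.sqrt d)).mulVec
          (postState d ξsq σsq (1 / 2) n₀ J x))
      = charExp (1 / (2 * d)) ^ (J + 1) * shiftForm hd 1
        (fun n => hitFactor hd 2 n * (heisenbergStep hd σsq)^[J] G n)
        (initialState d ξsq n₀) := by
  induction J generalizing G with
  | zero =>
    rw [show (Set.pi Set.univ fun _ : Fin 0 => Set.Icc (-(Real.sqrt d / 2)) (Real.sqrt d / 2))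
      = Set.univ from Set.eq_univ_of_forall fun x i => i.elim0,
      MeasureTheory.Measure.restrict_univ, MeasureTheory.volume_pi,
      MeasureTheory.Measure.pi_of_empty, MeasureTheory.integral_dirac]
    simp only [postState, shiftForm_one_evolution, zero_add, pow_one, Function.iterate_zero, id]
  | succ J ih =>
    have hc : Continuous fun x => shiftForm hd 1 (fun n => hitFactor hd 2 n * G n)
        (postState d ξsq σsq (1 / 2) n₀ (J + 1) x) :=
      (continuous_shiftForm hd 1 _).comp (continuous_postState hd ξsq hσ (1 / 2) n₀ (J + 1))
    simp only [shiftForm_one_evolution] at ih ⊢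
    rw [MeasureTheory.integral_const_mul, setIntegral_pi_snoc isCompact_Icc hc]
    simp only [postState_snoc, integral_shiftForm_kraus hd hσ, shiftForm_one_evolution]
    -- The last measurement acts on the observable first, which is why the induction runs over all
    -- `G`.
    have h := ih (heisenbergStep hd σsq G)
    rw [heisenbergStep] at h
    rw [h, Function.iterate_succ_apply, heisenbergStep]
    ring

theorem walkValue_eq_iterate (hd : Odd d) (σsq : ℝ) (n : ℕ) (p : Idx d) :
    walkValue d σsq 2 n p = hitFactor hd 2 p * (heisenbergStep hd σsq)^[n] (fun _ => 1) p := by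
  induction n generalizing p with
  | zero => simp [walkValue_zero hd]
  | succ n ih =>
    rw [walkValue_succ hd, Function.iterate_succ_apply', heisenbergStep, funext ih]

/-- The phases from the evolution have modulus 1 and the outcome coefficient at most 1, so only the
walk expectation remains. The `J + 1` evolutions correspond to the `J + 1` positions of a walk with
`J` jumps. -/
theorem norm_outcomeCharacter_last_le (hd : Odd d) {ξsq σsq M : ℝ} (hξ : 0 < ξsq) (hσ : 0 < σsq)
    (n₀ : ℤ) (J : ℕ) (hM : ∀ p : Idx d, |walkValue d σsq 2 J p| ≤ M) :
    ‖outcomeCharacter d ξsq σsq (1 / 2) n₀ (J + 1) (Fin.last J)‖ ≤ M := by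
  rw [outcomeCharacter_last hd ξsq hσ, integral_shiftForm_postState hd ξsq hσ]
  simp only [← walkValue_eq_iterate]
  have h := norm_shiftForm_one_le hd hM (initialState d ξsq n₀)
  rw [sum_norm_sq_initialState hd hξ, mul_one] at h
  rw [norm_mul, norm_mul, norm_pow, norm_charExp, one_pow, one_mul, Complex.norm_real,
    Real.norm_eq_abs]
  exact (mul_le_of_le_one_left (norm_nonneg _) (abs_outcomeCoeff_le hd hσ)).trans h

theorem norm_outcomeCharacter_le (hd : Odd d) {ξsq σsq M : ℝ} (hξ : 0 < ξsq) (hσ : 0 < σsq)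
    (n₀ : ℤ) (J : ℕ) (i : Fin J) (hM : ∀ p : Idx d, |walkValue d σsq 2 i p| ≤ M) :
    ‖outcomeCharacter d ξsq σsq (1 / 2) n₀ J i‖ ≤ M := by
  induction J with
  | zero => exact i.elim0
  | succ J ih =>
    induction i using Fin.lastCases with
    | last => exact norm_outcomeCharacter_last_le hd hξ hσ n₀ J hM
    | cast i =>
      rw [outcomeCharacter_castSucc hd ξsq hσ]
      exact ih i hM

end QuasiIdealClock

theorem mainTheorem2 (c₂ : ℝ) (hc₂ : 0 < c₂) :
    (∀ c₃ ∈ Set.Icc (0 : ℝ) 2, ∃ c₅ : ℝ, 0 < c₅ ∧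
      ∀ t : ℝ, 0 < t → ∀ β : ℝ, β < -(1 / 2) → ∀ ε : ℝ, 0 < ε →
      ∃ g h : ℕ → ℝ,
        g =O[atTop] (fun d : ℕ => (d : ℝ) ^ (3 / 2 : ℝ) *
          Real.exp (-(Real.pi * ε * t / (2 * c₂) * (d : ℝ) ^ (-(1 / 2) - β)))) ∧
        h =O[atTop] (fun d : ℕ => Real.exp (-(c₅ * (d : ℝ) ^ |(|β| - 1)|))) ∧
        h =o[atTop] (fun _ : ℕ => (1 : ℝ)) ∧
        ∀ᶠ d : ℕ in atTop, Odd d →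
          ∀ n : ℕ, n + 1 = ⌈t * Real.sqrt d⌉₊ → ∀ p₁ : QuasiIdealClock.Idx d,
            QuasiIdealClock.walkExpectation d (c₂ * (d : ℝ) ^ β) n p₁
                (QuasiIdealClock.antipodeProduct d c₃ n)
              ≤ 1 - (1 - ε) * c₃ * (t / Real.sqrt d) * (1 + g d + h d)) ∧
    (∀ t : ℝ, 0 < t → ∀ β : ℝ, β < -(1 / 2) →
      ∀ c₁ : ℝ, 0 < c₁ → ∀ α : ℝ, -1 < α → α < 1 →
      ∃ r : ℕ → ℝ, r =o[atTop] (fun _ : ℕ => (1 : ℝ)) ∧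
        ∀ᶠ d : ℕ in atTop, Odd d →
          ∀ (n₀ : ℤ) (J : ℕ) (i : Fin J), (i : ℕ) + 1 = ⌈t * Real.sqrt d⌉₊ →
            ‖QuasiIdealClock.outcomeCharacter d (c₁ * (d : ℝ) ^ α) (c₂ * (d : ℝ) ^ β)
                (1 / 2) n₀ J i‖
              ≤ 1 - t / Real.sqrt d * (1 + r d)) := by
  -- All error functions are zero: in the first part the margin `ε` absorbs the corrections, in the
  -- second the spare factor of two. Any positive `c₅` then serves.
  refine ⟨fun c₃ hc₃ => ⟨1, one_pos, fun t ht β hβ ε hε => ⟨0, 0, isBigO_zero _ _, isBigO_zero _ _,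
    isLittleO_zero _ _, ?_⟩⟩, fun t ht β hβ c₁ hc₁ α _ _ => ⟨0, isLittleO_zero _ _, ?_⟩⟩
  · filter_upwards [QuasiIdealClock.eventually_walkValue_le hc₂ hc₃.1 hc₃.2 ht hβ hε]
      with d h hd n hn p
    simpa [QuasiIdealClock.walkValue] using h hd n hn p
  · filter_upwards [QuasiIdealClock.eventually_abs_walkValue_two_le hc₂ ht hβ]
      with d h hd n₀ J i hi
    have h0 : (0 : ℝ) < d := by exact_mod_cast hd.pos
    simpa using QuasiIdealClock.norm_outcomeCharacter_le hd (by positivity) (by positivity)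
      n₀ J i (h hd i hi)
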